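/- Let $\mathbb K$ be a (non-archimedean) local field with ring of integers $\mathfrak D$ and prime ideal $\mathfrak P$, let $dx$ be the Haar measure of $(\mathbb K,+)$ with $\int_{\mathfrak D}dx=1$, and let $|\cdot|$ be the absolute value given by $d(\alpha x)=|\alpha|\,dx$, $|0|=0$. Fix a continuous unitary character $e$ of $(\mathbb K,+)$ that is trivial on $\mathfrak D$ and nontrivial on $\mathfrak P^{-1}$, and let $\hat f$ denote the $L^2$-Fourier transform extending $\hat f(\xi)=\int_{\mathbb K}f(x)\,e(-\xi x)\,dx$. A function $\psi\in L^2(\mathbb K)$ is called an admissible wavelet if $c_\psi=\int_{\mathbb K}|\hat\psi(\xi)|^2\,|\xi|^{-1}d\xi<\infty$. For $a,b\in\mathbb K$, $a\ne0$, put $$\psi_{a,b}(x)=|a|^{-1/2}\,\psi\Big(\frac{x-b}{a}\Big),\qquad (K_\psi f)(a,b)=\int_{\mathbb K}f(x)\,\overline{\psi_{a,b}(x)}\,dx .$$ Let $\psi,\varphi,\chi$ be admissible wavelets with $c_\varphi\neq0$, and let $D(x,y,z)$ be a basic function for them, that is, a measurable function on $\mathbb K^3$ such that $D(\cdot,y,z)\in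 L^2(\mathbb K)$ for almost all $(y,z)$ and such that, for all $a\ne0$ and $b$, $$K_\varphi[D(\cdot,y,z)](a,b)=\overline{\psi_{a,b}(z)}\;\overline{\chi_{a,b}(y)}\qquad\text{for almost all }(y,z).$$ Define the translation $(\tau_xh)(y)=\int_{\mathbb K}D(x,y,z)\,h(z)\,dz$ and the associated convolution $(h\# g)(x)=\int_{\mathbb K}(\tau_xh)(y)\,g(y)\,dy$. **Theorem.** Let $h,g\in L^2(\mathbb K)$ be such that, for almost every $x$, the double integral $\iint_{\mathbb K^2} D(x,y,z)\,h(z)\,g(y)\,dy\,dz$ defining $(h\# g)(x)$ converges absolutely. Then $h\# g\in L^2(\mathbb K)$, and for all $a,b\in\mathbb K$ with $a\neq0$, $$K_\varphi[h\# g](a,b)=(K_\psi h)(a,b)\,(K_\chi g)(a,b).$$ -/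

import Mathlib

open MeasureTheory ValuativeRel Filter Topology ComplexConjugate
open scoped ENNReal NNReal

namespace LocalFieldWavelet

noncomputable section

variable {K : Type*} [Field K] [ValuativeRel K] [TopologicalSpace K]
  [IsNonarchimedeanLocalField K] [MeasurableSpace K] [BorelSpace K]

/-- The absolute value of a local field: the factor `|α|` by which multiplication by `α` scales
Haar measure, `d(α x) = |α| dx`, with `|0| = 0`. -/
def absVal (α : K) : ℝ :=
  open Classical in
  if h : α = 0 then 0 else ((distribHaarChar K (Units.mk0 α h) : ℝ≥0) : ℝ)

/-- The absolute value is the Haar modulus. -/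
theorem ofReal_absVal_mul (μ : Measure K) [μ.IsAddHaarMeasure] [μ.Regular] {α : K} (hα : α ≠ 0)
    (s : Set K) : ENNReal.ofReal (absVal α) * μ s = μ ((fun x => α * x) '' s) := by
  have h := distribHaarChar_mul μ (Units.mk0 α hα) s
  simp only [absVal, hα, dif_neg, not_false_eq_true, ENNReal.ofReal_coe_nnreal]
  exact h

/-- `e` is a continuous unitary character of the additive group of `K` that is trivial on the ring
of integers `𝔇`, and nontrivial on the fractional ideal `𝔓⁻¹ = {x | x 𝔓 ⊆ 𝔇}`, where `𝔓` is the
prime ideal of `𝔇`. -/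
structure IsFixedCharacter (e : AddChar K Circle) : Prop where
  continuous : Continuous e
  trivial_on_integers : ∀ x : K, valuation K x ≤ 1 → e x = 1
  nontrivial : ∃ x : K, (∀ y : K, valuation K y < 1 → valuation K (x * y) ≤ 1) ∧ e x ≠ 1

/-- `F` is the Fourier transform of `f ∈ L²(K)`: some sequence in `L¹ ∩ L²` tends to `f` in `L²`,
and its Fourier transforms `ξ ↦ ∫ u(x) e(-ξ x) dx` tend to `F` in `L²`. -/
def IsL2Fourier (e : AddChar K Circle) (μ : Measure K) (f F : K → ℂ) : Prop :=
  MemLp f 2 μ ∧ MemLp F 2 μ ∧ ∃ u : ℕ → K → ℂ,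
    (∀ n, MemLp (u n) 1 μ ∧ MemLp (u n) 2 μ) ∧
    Tendsto (fun n => eLpNorm (u n - f) 2 μ) atTop (𝓝 0) ∧
    Tendsto (fun n => eLpNorm (Fourier.fourierIntegral e μ (u n) - F) 2 μ) atTop (𝓝 0)

/-- The Fourier transform on `L²(K)` (determined almost everywhere). -/
def l2Fourier (e : AddChar K Circle) (μ : Measure K) (f : K → ℂ) : K → ℂ :=
  open Classical in
  if h : ∃ F, IsL2Fourier e μ f F then h.choose else 0

/-- The constant `c_ψ = ∫ |ψ̂(ξ)|² / |ξ| dξ`, with values in `[0, ∞]`. -/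
def admissibilityConstant (e : AddChar K Circle) (μ : Measure K) (ψ : K → ℂ) : ℝ≥0∞ :=
  ∫⁻ ξ, ‖l2Fourier e μ ψ ξ‖ₑ ^ 2 / ENNReal.ofReal (absVal ξ) ∂μ

/-- Admissible wavelets: `ψ ∈ L²(K)` and `c_ψ < ∞`. -/
def IsAdmissibleWavelet (e : AddChar K Circle) (μ : Measure K) (ψ : K → ℂ) : Prop :=
  MemLp ψ 2 μ ∧ admissibilityConstant e μ ψ < ∞

/-- The daughter wavelets `ψ_{a,b}(x) = |a|^{-1/2} ψ((x - b) / a)`. -/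
def daughter (ψ : K → ℂ) (a b x : K) : ℂ :=
  ((1 / √(absVal a) : ℝ) : ℂ) * ψ ((x - b) / a)

/-- The continuous wavelet transform `(K_ψ f)(a,b) = ∫ f(x) conj(ψ_{a,b}(x)) dx`. -/
def cwt (μ : Measure K) (ψ f : K → ℂ) (a b : K) : ℂ :=
  ∫ x, f x * conj (daughter ψ a b x) ∂μ

/-- `D` is the basic function of the wavelets `ψ, φ, χ`: a measurable function with
`D(·,y,z) ∈ L²(K)` and
`K_φ[D(·,y,z)](a,b) = conj(ψ_{a,b}(z)) conj(χ_{a,b}(y))`, for almost all `(y,z)`. -/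
structure IsBasicFunction (μ : Measure K) (ψ φ χ : K → ℂ) (D : K → K → K → ℂ) : Prop where
  aestronglyMeasurable :
    AEStronglyMeasurable (fun p : K × K × K => D p.1 p.2.1 p.2.2) (μ.prod (μ.prod μ))
  memLp : ∀ᵐ p : K × K ∂(μ.prod μ), MemLp (fun x => D x p.1 p.2) 2 μ
  cwt_eq : ∀ a b : K, a ≠ 0 → ∀ᵐ p : K × K ∂(μ.prod μ),
    cwt μ φ (fun x => D x p.1 p.2) a b = conj (daughter ψ a b p.2) * conj (daughter χ a b p.1)

/-- The translation `(τ_x h)(y) = ∫ D(x,y,z) h(z) dz`. -/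
def translation (μ : Measure K) (D : K → K → K → ℂ) (x : K) (h : K → ℂ) (y : K) : ℂ :=
  ∫ z, D x y z * h z ∂μ

/-- The associated convolution `(h # g)(x) = ∫ (τ_x h)(y) g(y) dy`. -/
def assocConv (μ : Measure K) (D : K → K → K → ℂ) (h g : K → ℂ) (x : K) : ℂ :=
  ∫ y, translation μ D x h y * g y ∂μ

end

end LocalFieldWavelet

/-! Formally, pairing `h # g` with `φ_{a,b}` and integrating over `x` first turns `D(x,y,z)` into
`conj ψ_{a,b}(z) conj χ_{a,b}(y)`, and the integral splits into the product. The hypothesis gives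
absolute convergence only in `(y,z)` for almost every `x`, so this use of Fubini is not available,
and the proof goes through a bounded form instead.

By admissibility, Plancherel and polarisation, `c_φ ⟨f,u⟩ = ⟨K_φ f, K_φ u⟩` in `L²(|a|⁻² da db)`.
For `H` in this space put `Λ_H(h,g) = ∫ K_ψ h · K_χ g · H` (`waveletForm`). It is bounded in `H`,
`h`, `g`, since `K_ψ h` is in `L²` and `K_χ g` is bounded. Its formal kernel is `S_H(y,z) = ∫ conj
ψ_{a,b}(z) conj χ_{a,b}(y) H` (`synthesis`), and for `H = conj (K_φ u)` this equals `c_φ ∫ D(x,y,z)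
conj u(x) dx` almost everywhere.

The heart is `IsWaveletPair.waveletForm_eq_integral`: if `S_H · (g ⊗ h)` is integrable, its integral
is `Λ_H(h,g)`. For integrable `H` this is Fubini. Approximating a general `H` costs an error of size
`|y - z|⁻¹`, too singular at the diagonal. The remedy is to multiply `h` by `e(ξ·)` and `g` by
`e(-ξ·)`. The kernel is then multiplied by `e(ξ(z - y))`, and `e(ξ(z - y)) - 1` vanishes near the
diagonal, so the approximation does pass to the difference of the modulated and unmodulated
identities. As `|ξ| → ∞` both modulated terms tend to `0` by Riemann–Lebesgue, which leaves the
identity itself.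

Testing `h # g` against its own truncations gives `h # g ∈ L²` by duality. Then `c_φ ⟨h # g, u⟩ =
Λ_{conj K_φ u}(h,g)` for all `u ∈ L²`, and `u = φ_{a,b}` gives the product formula. -/

namespace LocalFieldWavelet

/-! ### Topology of the local field and its absolute value. -/

section Field

variable {K : Type*} [Field K] [ValuativeRel K] [TopologicalSpace K]
  [IsNonarchimedeanLocalField K]

theorem exists_valuation_lt_one (K : Type*) [Field K] [ValuativeRel K] [TopologicalSpace K]
    [IsNonarchimedeanLocalField K] : ∃ ϖ : K, ϖ ≠ 0 ∧ valuation K ϖ < 1 := by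
  obtain ⟨r, h0, h1⟩ := Valuation.IsNontrivial.exists_lt_one (v := valuation K)
  exact ⟨r, by simpa using h0, h1⟩

theorem exists_valuation_pow_lt {ϖ : K} (h1 : valuation K ϖ < 1) {γ : ValueGroupWithZero K}
    (hγ : γ ≠ 0) : ∃ n : ℕ, valuation K (ϖ ^ n) < γ := by
  have : MulArchimedean (ValueGroupWithZero K) :=
    ValuativeRel.isRankLeOne_iff_mulArchimedean.mp inferInstance
  obtain ⟨n, hn⟩ := exists_pow_lt₀ h1 (Units.mk0 γ hγ)
  exact ⟨n, by simpa using hn⟩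

theorem exists_valuation_le_inv_pow {ϖ : K} (h0 : ϖ ≠ 0) (h1 : valuation K ϖ < 1) (x : K) :
    ∃ n : ℕ, valuation K x ≤ valuation K (ϖ ^ n)⁻¹ := by
  by_cases hx : x = 0
  · exact ⟨0, by simp [hx]⟩
  · obtain ⟨n, hn⟩ := exists_valuation_pow_lt h1 (γ := valuation K x⁻¹) (by simpa using hx)
    refine ⟨n, ?_⟩
    have hx' : 0 < valuation K x := by simpa [zero_lt_iff] using hx
    have hp : 0 < valuation K (ϖ ^ n) := by simp [zero_lt_iff, h0]
    rw [map_inv₀] at hn ⊢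
    exact ((lt_inv_comm₀ hp hx').1 hn).le

theorem antitone_valuation_pow {F : Type*} [Field F] [ValuativeRel F] {ϖ : F}
    (h1 : valuation F ϖ < 1) : Antitone fun n : ℕ => valuation F (ϖ ^ n) := by
  intro m n h
  simpa using pow_le_pow_right_of_le_one' h1.le h

/-- The balls of radius `|ϖ ^ n|` form a basis at `0`. With σ-compactness this leads to second
countability, on which measurability on products rests. -/
instance : (𝓝 (0 : K)).IsCountablyGenerated := by
  obtain ⟨ϖ, h0, h1⟩ := exists_valuation_lt_one K
  refine HasCountableBasis.isCountablyGenerated (ι := ℕ) (p := fun _ => True)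
    (s := fun n => {x : K | valuation K x < valuation K (ϖ ^ n)}) ⟨?_, Set.to_countable _⟩
  refine (IsValuativeTopology.hasBasis_nhds_zero' K).to_hasBasis (fun γ hγ => ?_) (fun n _ => ?_)
  · obtain ⟨n, hn⟩ := exists_valuation_pow_lt h1 hγ
    exact ⟨n, trivial, fun x hx => lt_trans hx hn⟩
  · exact ⟨valuation K (ϖ ^ n), by simp [h0], subset_rfl⟩

instance : SigmaCompactSpace K := by
  obtain ⟨ϖ, h0, h1⟩ := exists_valuation_lt_one K
  refine ⟨⟨fun n => {x | valuation K x ≤ valuation K (ϖ ^ n)⁻¹},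
    fun n => IsNonarchimedeanLocalField.isCompact_closedBall K _, ?_⟩⟩
  rw [Set.iUnion_eq_univ_iff]
  exact exists_valuation_le_inv_pow h0 h1

instance : SecondCountableTopology K := by
  let := IsTopologicalAddGroup.rightUniformSpace K
  have := isUniformAddGroup_of_addCommGroup (G := K)
  have : (uniformity K).IsCountablyGenerated := IsUniformAddGroup.uniformity_countably_generated
  let := UniformSpace.pseudoMetricSpace K
  infer_instance

instance : T2Space K := by
  refine IsTopologicalAddGroup.t2Space_of_zero_sep fun x hx => ?_
  refine ⟨{y | valuation K y < valuation K x}, ?_, by simp⟩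
  exact (IsValuativeTopology.hasBasis_nhds_zero' K).mem_of_mem (by simpa using hx)

theorem isClosed_valuation_le (γ : ValueGroupWithZero K) :
    IsClosed {x : K | valuation K x ≤ γ} :=
  (IsNonarchimedeanLocalField.isCompact_closedBall K γ).isClosed

theorem absVal_zero : absVal (0 : K) = 0 := by simp [absVal]

theorem absVal_pos {α : K} (hα : α ≠ 0) : 0 < absVal α := by
  simp only [absVal, hα, dif_neg, not_false_eq_true]
  exact_mod_cast distribHaarChar_pos

theorem absVal_nonneg (α : K) : 0 ≤ absVal α := by
  by_cases h : α = 0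
  · simp [h, absVal_zero]
  · exact (absVal_pos h).le

theorem absVal_mul (α β : K) : absVal (α * β) = absVal α * absVal β := by
  by_cases hα : α = 0
  · simp [hα, absVal_zero]
  by_cases hβ : β = 0
  · simp [hβ, absVal_zero]
  simp only [absVal, hα, hβ, mul_eq_zero, or_self, dif_neg, not_false_eq_true]
  rw [← NNReal.coe_mul, ← map_mul]
  congr 2
  ext; simp

theorem absVal_one : absVal (1 : K) = 1 := by
  have h := absVal_mul (1 : K) 1
  rw [mul_one] at h
  exact (mul_eq_left₀ (absVal_pos one_ne_zero).ne').1 h.symm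

theorem absVal_inv (α : K) : absVal α⁻¹ = (absVal α)⁻¹ := by
  by_cases hα : α = 0
  · simp [hα, absVal_zero]
  · refine eq_inv_of_mul_eq_one_left ?_
    rw [← absVal_mul, inv_mul_cancel₀ hα, absVal_one]

theorem absVal_neg_one : absVal (-1 : K) = 1 := by
  have h := absVal_mul (-1 : K) (-1)
  rw [neg_mul_neg, one_mul, absVal_one] at h
  nlinarith [absVal_nonneg (-1 : K)]

theorem absVal_neg (α : K) : absVal (-α) = absVal α := by
  rw [neg_eq_neg_one_mul, absVal_mul, absVal_neg_one, one_mul]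

/-- The modulus `|α|` as an extended nonnegative real. -/
noncomputable def eAbs (α : K) : ℝ≥0∞ := ENNReal.ofReal (absVal α)

theorem eAbs_ne_top (α : K) : eAbs α ≠ ∞ := ENNReal.ofReal_ne_top

theorem eAbs_ne_zero {α : K} (hα : α ≠ 0) : eAbs α ≠ 0 := by
  simpa [eAbs] using absVal_pos hα

theorem eAbs_mul (α β : K) : eAbs (α * β) = eAbs α * eAbs β := by
  rw [eAbs, absVal_mul, ENNReal.ofReal_mul (absVal_nonneg _)]; rfl

theorem eAbs_inv {α : K} (hα : α ≠ 0) : eAbs α⁻¹ = (eAbs α)⁻¹ := by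
  rw [eAbs, absVal_inv, ENNReal.ofReal_inv_of_pos (absVal_pos hα)]; rfl

theorem tendsto_pow_zero {ϖ : K} (h1 : valuation K ϖ < 1) :
    Tendsto (fun n : ℕ => ϖ ^ n) atTop (𝓝 0) := by
  refine (IsValuativeTopology.hasBasis_nhds_zero' K).tendsto_right_iff.2 fun γ hγ => ?_
  obtain ⟨n, hn⟩ := exists_valuation_pow_lt h1 hγ
  filter_upwards [eventually_ge_atTop n] with m hm
  exact (antitone_valuation_pow h1 hm).trans_lt hn

variable [MeasurableSpace K] [BorelSpace K]

theorem measurableSet_valuation_le (γ : ValueGroupWithZero K) :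
    MeasurableSet {x : K | valuation K x ≤ γ} :=
  (isClosed_valuation_le γ).measurableSet

variable (μ : Measure K) [μ.IsAddHaarMeasure]

theorem map_mul_left {α : K} (hα : α ≠ 0) :
    μ.map (fun x => α * x) = (eAbs α)⁻¹ • μ := by
  ext s hs
  rw [Measure.map_apply (measurable_const_mul α) hs, Measure.smul_apply, smul_eq_mul,
    ← eAbs_inv hα, eAbs, ofReal_absVal_mul μ (inv_ne_zero hα)]
  congr 1
  ext x
  simp only [Set.mem_preimage, Set.mem_image]
  constructor
  · intro h
    exact ⟨_, h, by field_simp⟩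
  · rintro ⟨y, hy, rfl⟩
    simpa [hα] using hy

theorem lintegral_mul_left {α : K} (hα : α ≠ 0) (f : K → ℝ≥0∞) :
    ∫⁻ x, f (α * x) ∂μ = (eAbs α)⁻¹ * ∫⁻ x, f x ∂μ := by
  have h := lintegral_map_equiv (μ := μ) f (MeasurableEquiv.mulLeft₀ α hα)
  simp only [MeasurableEquiv.coe_mulLeft₀] at h
  rw [← h, map_mul_left μ hα, lintegral_smul_measure, smul_eq_mul]

theorem quasiMeasurePreserving_mul_left {α : K} (hα : α ≠ 0) :
    Measure.QuasiMeasurePreserving (fun x => α * x) μ μ := by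
  refine ⟨measurable_const_mul α, ?_⟩
  rw [map_mul_left μ hα]
  exact Measure.smul_absolutelyContinuous

variable {μ}

theorem measure_valuation_le (hμ : μ {x : K | valuation K x ≤ 1} = 1) {t : K} (ht : t ≠ 0) :
    μ {x : K | valuation K x ≤ valuation K t} = eAbs t := by
  have h := ofReal_absVal_mul μ ht {x : K | valuation K x ≤ 1}
  rw [hμ, mul_one] at h
  rw [eAbs, h]
  congr 1
  ext x
  simp only [Set.mem_ofPred_eq, Set.mem_image]
  constructor
  · intro hx
    refine ⟨t⁻¹ * x, ?_, by field_simp⟩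
    rw [map_mul, map_inv₀]
    exact inv_mul_le_one_of_le₀ hx zero_le
  · rintro ⟨y, hy, rfl⟩
    rw [map_mul]
    exact mul_le_of_le_one_right' hy

theorem absVal_le_absVal (hμ : μ {x : K | valuation K x ≤ 1} = 1) {s t : K} (hs : s ≠ 0)
    (h : valuation K s ≤ valuation K t) : absVal s ≤ absVal t := by
  have ht : t ≠ 0 := by
    rintro rfl
    exact hs (by simpa using h)
  have := measure_mono (μ := μ) (fun x (hx : valuation K x ≤ valuation K s) => hx.trans h)
  have h2 : eAbs s ≤ eAbs t := by
    rw [← measure_valuation_le hμ hs, ← measure_valuation_le hμ ht]; exact this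
  exact (ENNReal.ofReal_le_ofReal_iff (absVal_nonneg _)).1 h2

/-- Away from `0` the modulus is locally constant: it is the volume of a ball determined by the
valuation, and the valuation is locally constant there. -/
theorem measurable_absVal (hμ : μ {x : K | valuation K x ≤ 1} = 1) :
    Measurable (absVal : K → ℝ) := by
  have hc : ContinuousOn (absVal : K → ℝ) {0}ᶜ := by
    intro x hx
    have hx : x ≠ 0 := hx
    apply ContinuousAt.continuousWithinAt
    refine ContinuousAt.congr (f := fun _ => absVal x) continuousAt_const ?_
    filter_upwards [(valuation K).locally_const (x := x) (by simpa using hx)] with y hy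
    have hy0 : y ≠ 0 := by
      rintro rfl
      exact hx (by simpa using hy.symm)
    exact le_antisymm (absVal_le_absVal hμ hx (le_of_eq hy.symm))
      (absVal_le_absVal hμ hy0 (le_of_eq hy))
  refine measurable_of_measurable_on_compl_singleton 0 ?_
  exact (continuousOn_iff_continuous_domRestrict.1 hc).measurable

end Field

/-! ### Continuity of translation in `Lp` and a Riemann–Lebesgue lemma. -/

section Translation

variable {G : Type*} [AddCommGroup G] [TopologicalSpace G] [IsTopologicalAddGroup G]
  [LocallyCompactSpace G] [SecondCountableTopology G] [T2Space G] [MeasurableSpace G]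
  [BorelSpace G] {ρ : Measure G} [ρ.IsAddHaarMeasure]

theorem tendsto_eLpNorm_translate_sub {p : ℝ≥0∞} (hp1 : 1 ≤ p) (hp : p ≠ ∞) {f : G → ℂ}
    (hf : MemLp f p ρ) :
    Tendsto (fun s => eLpNorm (fun x => f (x + s) - f x) p ρ) (𝓝 0) (𝓝 0) := by
  have : Fact (1 ≤ p) := ⟨hp1⟩
  let g : G → C(G, G) := fun s => ⟨fun x => x + s, by fun_prop⟩
  have hg : Continuous g :=
    (ContinuousMap.curry ⟨fun q : G × G => q.2 + q.1, by fun_prop⟩).continuous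
  have hgm : ∀ s, MeasurePreserving (g s) ρ ρ := fun s => measurePreserving_add_right ρ s
  have key := Tendsto.compMeasurePreservingLp (p := p) (E := ℂ) (l := 𝓝 (0 : G))
    (f := fun _ : G => hf.toLp f) tendsto_const_nhds hg.continuousAt hgm (hgm 0) hp
  rw [Lp.tendsto_Lp_iff_tendsto_eLpNorm'] at key
  refine key.congr fun s => eLpNorm_congr_ae ?_
  have h1 := Lp.coeFn_compMeasurePreserving (hf.toLp f) (hgm s)
  have h2 := Lp.coeFn_compMeasurePreserving (hf.toLp f) (hgm 0)
  have h3 := hf.coeFn_toLp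
  filter_upwards [h1, h2, h3, (hgm s).quasiMeasurePreserving.ae h3,
    (hgm 0).quasiMeasurePreserving.ae h3] with x e1 e2 e3 e4 e5
  rw [Pi.sub_apply, e1, e2, Function.comp_apply, Function.comp_apply, e4, e5]
  simp [g]

/-- Translating by `v n` gives `(1 - c) ∫ W E = c ∫ (W(· + v n) - W) E`. Since `|E| = 1` and `c ≠
1`, the integral is controlled by the `L¹` modulus of continuity of `W`. -/
theorem tendsto_integral_mul_of_quasiperiodic {W : G → ℂ} (hW : Integrable W ρ)
    {E : ℕ → G → ℂ} (hE : ∀ n, Measurable (E n)) (hE1 : ∀ n x, ‖E n x‖ = 1)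
    {v : ℕ → G} (hv : Tendsto v atTop (𝓝 0)) {c : ℂ} (hc : c ≠ 1)
    (hEv : ∀ n x, E n (x + v n) = c * E n x) :
    Tendsto (fun n => ∫ x, W x * E n x ∂ρ) atTop (𝓝 0) := by
  have hint : ∀ n, Integrable (fun x => W x * E n x) ρ := fun n =>
    hW.mul_bdd (c := 1) (hE n).aestronglyMeasurable (ae_of_all _ fun x => (hE1 n x).le)
  have hc1 : ‖c‖ = 1 := by
    have := congrArg norm (hEv 0 0)
    rw [norm_mul, hE1, hE1, mul_one] at this
    exact this.symm
  have hWs : ∀ n, Integrable (fun x => W (x + v n)) ρ := fun n => hW.comp_add_right (v n)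
  have hints : ∀ n, Integrable (fun x => W (x + v n) * E n x) ρ := fun n =>
    (hWs n).mul_bdd (c := 1) (hE n).aestronglyMeasurable (ae_of_all _ fun x => (hE1 n x).le)
  have key : ∀ n, ‖∫ x, W x * E n x ∂ρ‖ * ‖1 - c‖ ≤
      (eLpNorm (fun x => W (x + v n) - W x) 1 ρ).toReal := by
    intro n
    have h1 : ∫ x, W x * E n x ∂ρ = c * ∫ x, W (x + v n) * E n x ∂ρ := by
      rw [← integral_add_right_eq_self (fun x => W x * E n x) (v n), ← integral_const_mul]
      refine integral_congr_ae (ae_of_all _ fun x => ?_)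
      simp only [hEv]; ring
    have h2 : (∫ x, W x * E n x ∂ρ) * (1 - c) =
        c * ∫ x, (W (x + v n) - W x) * E n x ∂ρ := by
      have h3 : ∫ x, (W (x + v n) - W x) * E n x ∂ρ =
          ∫ x, W (x + v n) * E n x ∂ρ - ∫ x, W x * E n x ∂ρ := by
        rw [← integral_sub (hints n) (hint n)]
        simp only [sub_mul]
      rw [h3]
      linear_combination h1
    have h4 : (eLpNorm (fun x => W (x + v n) - W x) 1 ρ).toReal =
        ∫ x, ‖W (x + v n) - W x‖ ∂ρ := by
      rw [eLpNorm_one_eq_lintegral_enorm]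
      exact (integral_norm_eq_lintegral_enorm ((hWs n).sub hW).aestronglyMeasurable).symm
    rw [← norm_mul, h2, norm_mul, hc1, one_mul, h4]
    refine (norm_integral_le_integral_norm _).trans (le_of_eq ?_)
    simp [hE1]
  have hlim : Tendsto (fun n => (eLpNorm (fun x => W (x + v n) - W x) 1 ρ).toReal) atTop (𝓝 0) := by
    have := (tendsto_eLpNorm_translate_sub le_rfl ENNReal.one_ne_top
      (memLp_one_iff_integrable.2 hW)).comp hv
    exact (ENNReal.tendsto_toReal ENNReal.zero_ne_top).comp this
  have hc0 : 0 < ‖1 - c‖ := norm_pos_iff.2 (sub_ne_zero.2 (Ne.symm hc))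
  refine squeeze_zero_norm (fun n => (le_div_iff₀ hc0).2 (key n)) ?_
  simpa using hlim.div_const ‖1 - c‖

end Translation

/-! ### Plancherel's identity for integrable square integrable functions. -/

section Plancherel

variable {K : Type*} [Field K] [ValuativeRel K] [TopologicalSpace K]
  [IsNonarchimedeanLocalField K] [MeasurableSpace K] [BorelSpace K]
  {μ : Measure K} [μ.IsAddHaarMeasure] {e : AddChar K Circle}

/-- If `|s| > 1` then `s⁻¹ ∈ 𝔓`, so any `x ∈ 𝔓⁻¹` satisfies `x s⁻¹ ∈ 𝔇`: every ball larger than `𝔇`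
contains `𝔓⁻¹`. -/
theorem IsFixedCharacter.exists_valuation_le (he : IsFixedCharacter e) {s : K}
    (hs : 1 < valuation K s) : ∃ x : K, valuation K x ≤ valuation K s ∧ e x ≠ 1 := by
  obtain ⟨x, hx, hex⟩ := he.nontrivial
  refine ⟨x, ?_, hex⟩
  have hs0 : 0 < valuation K s := zero_lt_one.trans hs
  have := hx s⁻¹ (by rw [map_inv₀]; exact inv_lt_one_of_one_lt₀ hs)
  rw [map_mul, map_inv₀] at this
  rwa [← div_eq_mul_inv, div_le_one₀ hs0] at this

/-- Orthogonality of characters on a compact subgroup: either the character is trivial on the ball,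
or translating by an element of the ball multiplies the integral by a number other than `1`. -/
theorem setIntegral_character (hμ : μ {x : K | valuation K x ≤ 1} = 1)
    (he : IsFixedCharacter e) {r : K} (hr : r ≠ 0) (t : K) :
    ∫ ξ in {ξ : K | valuation K ξ ≤ valuation K r}, (e (-(t * ξ)) : ℂ) ∂μ =
      if valuation K (t * r) ≤ 1 then (absVal r : ℂ) else 0 := by
  have hV := measurableSet_valuation_le (valuation K r)
  split_ifs with h
  · have : ∀ ξ ∈ {ξ : K | valuation K ξ ≤ valuation K r}, (e (-(t * ξ)) : ℂ) = 1 := by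
      intro ξ hξ
      rw [he.trivial_on_integers, Circle.coe_one]
      rw [Valuation.map_neg, map_mul]
      rw [map_mul] at h
      exact (mul_le_mul_right hξ _).trans h
    rw [setIntegral_congr_fun hV this]
    simp [Measure.real, measure_valuation_le hμ hr, eAbs, absVal_nonneg]
  · obtain ⟨x, hx, hex⟩ := he.exists_valuation_le (not_le.1 h)
    have ht : t ≠ 0 := by rintro rfl; simp at h
    set V := {ξ : K | valuation K ξ ≤ valuation K r} with hVdef
    -- Chosen so that `-(t * ξ₀) = x`, where `e x ≠ 1`.
    set ξ₀ : K := -(x / t) with hξ₀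
    have hmem : ∀ ξ, ξ + ξ₀ ∈ V ↔ ξ ∈ V := by
      have h0 : valuation K ξ₀ ≤ valuation K r := by
        have ht0 : 0 < valuation K t := by simpa [zero_lt_iff] using ht
        rw [hξ₀, Valuation.map_neg, map_div₀, div_le_iff₀ ht0, mul_comm, ← map_mul]
        exact hx
      intro ξ
      constructor
      · intro h1
        have := (valuation K).map_sub (ξ + ξ₀) ξ₀
        rw [add_sub_cancel_right] at this
        exact this.trans (max_le h1 h0)
      · intro h1
        exact ((valuation K).map_add ξ ξ₀).trans (max_le h1 h0)
    have h1 : ∫ ξ in V, (e (-(t * ξ)) : ℂ) ∂μ =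
        (e x : ℂ) * ∫ ξ in V, (e (-(t * ξ)) : ℂ) ∂μ := by
      rw [← integral_indicator hV]
      conv_lhs => rw [← integral_add_right_eq_self _ ξ₀]
      rw [← integral_const_mul]
      refine integral_congr_ae (ae_of_all _ fun ξ => ?_)
      simp only [Set.indicator, hmem]
      split_ifs
      · rw [← Circle.coe_mul, ← e.map_add_eq_mul]
        congr 2
        rw [hξ₀]; field_simp; ring
      · simp
    have h2 : (1 - (e x : ℂ)) * ∫ ξ in V, (e (-(t * ξ)) : ℂ) ∂μ = 0 := by
      rw [sub_mul, one_mul, ← h1, sub_self]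
    refine (mul_eq_zero.1 h2).resolve_left (sub_ne_zero.2 fun h3 => hex ?_)
    exact Circle.coe_eq_one.1 h3.symm

theorem fourierIntegral_apply (f : K → ℂ) (ξ : K) :
    Fourier.fourierIntegral e μ f ξ = ∫ x, (e (-(x * ξ)) : ℂ) * f x ∂μ := by
  simp [Fourier.fourierIntegral_def, Circle.smul_def]

theorem continuous_fourierIntegral (he : IsFixedCharacter e) {f : K → ℂ} (hf : Integrable f μ) :
    Continuous (Fourier.fourierIntegral e μ f) :=
  VectorFourier.fourierIntegral_continuous he.continuous
    (by simpa using continuous_mul) hf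

theorem measurable_character (he : IsFixedCharacter e) {X : Type*} [MeasurableSpace X]
    {u : X → K} (hu : Measurable u) : Measurable fun x => (e (u x) : ℂ) :=
  (continuous_subtype_val.comp he.continuous).measurable.comp hu

/-- The autocorrelation of a square integrable function. -/
noncomputable def autocorrelation (μ : Measure K) (f : K → ℂ) (s : K) : ℂ :=
  ∫ y, conj (f y) * f (y + s) ∂μ

/-- Expanding `|f̂|²` as a double integral and integrating in `ξ` first leaves `|r|` times the
indicator that the two variables differ by an element of the dual ball. The shear `(y, s) ↦ (y, y +
s)` then exhibits the autocorrelation. -/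
theorem setIntegral_fourierIntegral_mul_conj (hμ : μ {x : K | valuation K x ≤ 1} = 1)
    (he : IsFixedCharacter e) {f : K → ℂ} (hf : Integrable f μ) {r : K} (hr : r ≠ 0) :
    ∫ ξ in {ξ : K | valuation K ξ ≤ valuation K r},
        Fourier.fourierIntegral e μ f ξ * conj (Fourier.fourierIntegral e μ f ξ) ∂μ =
      (absVal r : ℂ) * ∫ s in {s : K | valuation K s ≤ valuation K r⁻¹},
        autocorrelation μ f s ∂μ := by
  set V := {ξ : K | valuation K ξ ≤ valuation K r} with hV
  have hVm : MeasurableSet V := measurableSet_valuation_le _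
  have hVfin : IsFiniteMeasure (μ.restrict V) :=
    ⟨by rw [Measure.restrict_apply_univ, hV, measure_valuation_le hμ hr]
        exact (eAbs_ne_top r).lt_top⟩
  have hfc : Integrable (fun x => conj (f x)) μ :=
    (LinearIsometryEquiv.integrable_comp_iff (𝕜 := ℝ) Complex.conjLIE).2 hf
  have hff : Integrable (fun p : K × K => conj (f p.1) * f p.2) (μ.prod μ) := hfc.mul_prod hf
  have hunit : ∀ x : K, ‖(e x : ℂ)‖ = 1 := fun x => Circle.norm_coe _
  have h1 : ∀ ξ, Fourier.fourierIntegral e μ f ξ * conj (Fourier.fourierIntegral e μ f ξ) =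
      ∫ p : K × K, conj (f p.1) * f p.2 * (e (-((p.2 - p.1) * ξ)) : ℂ) ∂(μ.prod μ) := by
    intro ξ
    rw [mul_comm, fourierIntegral_apply, ← integral_conj, ← integral_prod_mul]
    refine integral_congr_ae (ae_of_all _ fun p => ?_)
    have : (e (-((p.2 - p.1) * ξ)) : ℂ) = conj (e (-(p.1 * ξ)) : ℂ) * (e (-(p.2 * ξ)) : ℂ) := by
      rw [← Circle.coe_inv_eq_conj, ← AddChar.map_neg_eq_inv, ← Circle.coe_mul,
        ← e.map_add_eq_mul]
      congr 2; ring
    simp only [map_mul, this]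
    ring
  simp_rw [h1]
  rw [integral_integral_swap]
  swap
  · refine Integrable.mul_bdd (c := 1) (hff.comp_snd _) ?_ (ae_of_all _ fun q => (hunit _).le)
    exact (measurable_character he (by fun_prop)).aestronglyMeasurable
  have hchar : ∀ t, ∫ ξ in V, (e (-(t * ξ)) : ℂ) ∂μ =
      if valuation K (t * r) ≤ 1 then (absVal r : ℂ) else 0 := setIntegral_character hμ he hr
  simp_rw [integral_const_mul, hchar]
  have hW : MeasurableSet {s : K | valuation K s ≤ valuation K r⁻¹} :=
    measurableSet_valuation_le _
  have hiff : ∀ s : K, valuation K (s * r) ≤ 1 ↔ valuation K s ≤ valuation K r⁻¹ := by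
    intro s
    have hr0 : 0 < valuation K r := by simpa [zero_lt_iff] using hr
    rw [map_mul, map_inv₀, ← one_div, le_div_iff₀ hr0]
  simp_rw [hiff]
  have hsh : MeasurePreserving (fun q : K × K => (q.1, q.1 + q.2)) (μ.prod μ) (μ.prod μ) :=
    measurePreserving_prod_add μ μ
  have hemb : MeasurableEmbedding (fun q : K × K => (q.1, q.1 + q.2)) :=
    (MeasurableEquiv.shearAddRight K).measurableEmbedding
  rw [← hsh.integral_comp hemb (fun p : K × K => conj (f p.1) * f p.2 *
    if valuation K (p.2 - p.1) ≤ valuation K r⁻¹ then (absVal r : ℂ) else 0),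
    ← integral_indicator hW, ← integral_const_mul, integral_prod_symm]
  · refine integral_congr_ae (ae_of_all _ fun s => ?_)
    simp only [Set.indicator, Set.mem_ofPred_eq, add_sub_cancel_left]
    rw [integral_mul_const, mul_comm]
    split_ifs <;> simp [autocorrelation]
  · have hb : Measurable fun q : K × K =>
        if valuation K (q.1 + q.2 - q.1) ≤ valuation K r⁻¹ then (absVal r : ℂ) else 0 := by
      refine Measurable.ite ?_ measurable_const measurable_const
      have : Measurable fun q : K × K => q.1 + q.2 - q.1 := by fun_prop
      exact this hW
    refine Integrable.mul_bdd (c := absVal r)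
      (hsh.integrable_comp_of_integrable hff) hb.aestronglyMeasurable (ae_of_all _ fun q => ?_)
    split_ifs <;> simp [abs_of_nonneg, absVal_nonneg]

theorem integrable_autocorrelation {f : K → ℂ} (hf : Integrable f μ) :
    Integrable (autocorrelation μ f) μ := by
  have hfc : Integrable (fun x => conj (f x)) μ :=
    (LinearIsometryEquiv.integrable_comp_iff (𝕜 := ℝ) Complex.conjLIE).2 hf
  have hff : Integrable (fun p : K × K => conj (f p.1) * f p.2) (μ.prod μ) := hfc.mul_prod hf
  exact ((measurePreserving_prod_add μ μ).integrable_comp_of_integrable hff).integral_prod_right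

theorem autocorrelation_zero {f : K → ℂ} (hf : MemLp f 2 μ) :
    autocorrelation μ f 0 = ((∫⁻ x, ‖f x‖ₑ ^ 2 ∂μ).toReal : ℂ) := by
  have h : ∀ y, conj (f y) * f (y + 0) = ((‖f y‖ ^ 2 : ℝ) : ℂ) := by
    intro y
    rw [add_zero, Complex.conj_mul']
    norm_cast
  have h2 : ∫ y, ‖f y‖ ^ 2 ∂μ = (∫⁻ x, ‖f x‖ₑ ^ 2 ∂μ).toReal := by
    have hm : AEStronglyMeasurable (fun y => ‖f y‖ ^ 2) μ := hf.1.norm.pow 2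
    rw [integral_eq_lintegral_of_nonneg_ae (ae_of_all _ fun y => sq_nonneg _) hm]
    simp [ENNReal.ofReal_pow]
  simp_rw [autocorrelation, h]
  rw [integral_complex_ofReal, h2]

theorem eLpNorm_two_sq {X : Type*} [MeasurableSpace X] {ν : Measure X} (f : X → ℂ) :
    eLpNorm f 2 ν ^ 2 = ∫⁻ x, ‖f x‖ₑ ^ 2 ∂ν := by
  have := eLpNorm_nnreal_pow_eq_lintegral (μ := ν) (f := f) (p := 2) two_ne_zero
  simpa using this

theorem norm_integral_mul_le {X : Type*} [MeasurableSpace X] {ν : Measure X} {f g : X → ℂ}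
    (hf : MemLp f 2 ν) (hg : MemLp g 2 ν) :
    ‖∫ x, f x * g x ∂ν‖ ≤ (eLpNorm f 2 ν).toReal * (eLpNorm g 2 ν).toReal := by
  have h1 : eLpNorm (f * g) 1 ν ≤ eLpNorm f 2 ν * eLpNorm g 2 ν := by
    simpa using eLpNorm_smul_le_mul_eLpNorm (p := 2) (q := 2) (r := 1) hg.1 hf.1
  rw [eLpNorm_one_eq_lintegral_enorm] at h1
  have h2 : ‖∫ x, f x * g x ∂ν‖ₑ ≤ eLpNorm f 2 ν * eLpNorm g 2 ν :=
    (enorm_integral_le_lintegral_enorm _).trans h1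
  rw [← ENNReal.toReal_mul, ← toReal_enorm]
  exact ENNReal.toReal_mono (ENNReal.mul_ne_top hf.2.ne hg.2.ne) h2

theorem memLp_conj {X : Type*} [MeasurableSpace X] {ν : Measure X} {f : X → ℂ} {p : ℝ≥0∞}
    (hf : MemLp f p ν) : MemLp (fun x => conj (f x)) p ν := hf.star

/-- Cauchy–Schwarz reduces this to continuity of translation in `L²`. -/
theorem tendsto_autocorrelation {f : K → ℂ} (hf : MemLp f 2 μ) :
    Tendsto (autocorrelation μ f) (𝓝 0) (𝓝 (autocorrelation μ f 0)) := by
  rw [tendsto_iff_norm_sub_tendsto_zero]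
  have hs : ∀ s, MemLp (fun y => f (y + s)) 2 μ := fun s =>
    hf.comp_measurePreserving (measurePreserving_add_right μ s)
  have hfc := memLp_conj hf
  have hb : ∀ s, ‖autocorrelation μ f s - autocorrelation μ f 0‖ ≤
      (eLpNorm f 2 μ).toReal * (eLpNorm (fun y => f (y + s) - f y) 2 μ).toReal := by
    intro s
    have h1 : autocorrelation μ f s - autocorrelation μ f 0 =
        ∫ y, conj (f y) * (f (y + s) - f y) ∂μ := by
      have hi : ∀ s, Integrable (fun y => conj (f y) * f (y + s)) μ := fun s =>
        hfc.integrable_mul (hs s)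
      rw [autocorrelation, autocorrelation, ← integral_sub (hi s) (hi 0)]
      simp [mul_sub]
    rw [h1]
    refine (norm_integral_mul_le hfc ((hs s).sub hf)).trans (le_of_eq ?_)
    congr 2
    exact eLpNorm_congr_norm_ae (ae_of_all _ fun x => by simp)
  refine squeeze_zero (fun s => norm_nonneg _) hb ?_
  have := (ENNReal.tendsto_toReal ENNReal.zero_ne_top).comp
    (tendsto_eLpNorm_translate_sub one_le_two ENNReal.ofNat_ne_top hf)
  simpa using this.const_mul _

/-- Plancherel's identity on `L¹ ∩ L²`. -/
theorem lintegral_enorm_fourierIntegral_sq (hμ : μ {x : K | valuation K x ≤ 1} = 1)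
    (he : IsFixedCharacter e) {f : K → ℂ} (hf : Integrable f μ) (hf2 : MemLp f 2 μ) :
    ∫⁻ ξ, ‖Fourier.fourierIntegral e μ f ξ‖ₑ ^ 2 ∂μ = ∫⁻ x, ‖f x‖ₑ ^ 2 ∂μ := by
  obtain ⟨ϖ, h0, h1⟩ := exists_valuation_lt_one K
  set F := Fourier.fourierIntegral e μ f with hF
  have hFc : Continuous F := continuous_fourierIntegral he hf
  let V : ℕ → Set K := fun n => {ξ | valuation K ξ ≤ valuation K (ϖ ^ n)⁻¹}
  let U : ℕ → Set K := fun n => {s | valuation K s ≤ valuation K (ϖ ^ n)}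
  have hV : AECover μ atTop V := by
    refine ⟨ae_of_all _ fun x => ?_, fun n => measurableSet_valuation_le _⟩
    obtain ⟨n, hn⟩ := exists_valuation_le_inv_pow h0 h1 x
    filter_upwards [eventually_ge_atTop n] with m hm
    change valuation K x ≤ valuation K (ϖ ^ m)⁻¹
    refine hn.trans ?_
    rw [map_inv₀, map_inv₀]
    exact inv_anti₀ (by simp [zero_lt_iff, h0]) (antitone_valuation_pow h1 hm)
  have hlim := hV.lintegral_tendsto_of_nat (f := fun ξ => ‖F ξ‖ₑ ^ 2)
    (hFc.enorm.measurable.pow_const 2).aemeasurable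
  refine tendsto_nhds_unique hlim ?_
  have hL2 : ∫⁻ x, ‖f x‖ₑ ^ 2 ∂μ ≠ ∞ := by
    rw [← eLpNorm_two_sq]; exact ENNReal.pow_ne_top hf2.2.ne
  have hVfin : ∀ n, μ (V n) < ∞ := fun n => by
    simp only [V]
    rw [measure_valuation_le hμ (inv_ne_zero (pow_ne_zero n h0))]
    exact (eAbs_ne_top _).lt_top
  have hVF : ∀ n, ∫⁻ ξ in V n, ‖F ξ‖ₑ ^ 2 ∂μ =
      ENNReal.ofReal ‖∫ ξ in V n, F ξ * conj (F ξ) ∂μ‖ := by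
    intro n
    have h2 : ∀ ξ, F ξ * conj (F ξ) = ((‖F ξ‖ ^ 2 : ℝ) : ℂ) := fun ξ => by
      rw [Complex.mul_conj']; norm_cast
    simp_rw [h2]
    rw [integral_complex_ofReal, Complex.norm_real, Real.norm_of_nonneg
      (integral_nonneg fun ξ => by positivity), ofReal_integral_eq_lintegral_ofReal]
    · simp [ENNReal.ofReal_pow]
    · have hK : IsCompact (V n) := IsNonarchimedeanLocalField.isCompact_closedBall K _
      exact ((hFc.norm.pow 2).continuousOn.integrableOn_compact hK)
    · exact ae_of_all _ fun ξ => by positivity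
  simp_rw [hVF]
  -- The balls `U n` are dual to the `V n` and have measure `|ϖ ^ n|`. The right side is therefore
  -- the mean of the autocorrelation over balls shrinking to `0`, which tends to its value `‖f‖²` at
  -- `0`.
  have hE : ∀ n, ∫ ξ in V n, F ξ * conj (F ξ) ∂μ =
      ∫ s in U n, (absVal (ϖ ^ n)⁻¹ : ℂ) * autocorrelation μ f s ∂μ := by
    intro n
    rw [integral_const_mul]
    have := setIntegral_fourierIntegral_mul_conj hμ he hf (inv_ne_zero (pow_ne_zero n h0))
    simpa only [inv_inv] using this
  have hconv : Tendsto (fun n => ∫ ξ in V n, F ξ * conj (F ξ) ∂μ) atTop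
      (𝓝 (autocorrelation μ f 0)) := by
    simp_rw [hE]
    rw [Metric.tendsto_atTop]
    intro ε hε
    obtain ⟨γ, hγ, hsub⟩ := (IsValuativeTopology.hasBasis_nhds_zero' K).mem_iff.1
      (tendsto_autocorrelation hf2 (Metric.closedBall_mem_nhds _ (half_pos hε)))
    obtain ⟨N, hN⟩ := exists_valuation_pow_lt h1 hγ
    refine ⟨N, fun n hn => lt_of_le_of_lt ?_ (half_lt_self hε)⟩
    have hU : μ (U n) = eAbs (ϖ ^ n) := measure_valuation_le hμ (pow_ne_zero n h0)
    have hq : 0 < absVal (ϖ ^ n) := absVal_pos (pow_ne_zero n h0)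
    have hclose : ∀ s ∈ U n, ‖(absVal (ϖ ^ n)⁻¹ : ℂ) * autocorrelation μ f s -
        (absVal (ϖ ^ n)⁻¹ : ℂ) * autocorrelation μ f 0‖ ≤ (absVal (ϖ ^ n))⁻¹ * (ε / 2) := by
      intro s hs
      have : s ∈ {x : K | valuation K x < γ} :=
        lt_of_le_of_lt (le_trans hs (antitone_valuation_pow h1 hn)) hN
      have h3 := hsub this
      rw [Set.mem_preimage, Metric.mem_closedBall, dist_eq_norm] at h3
      rw [← mul_sub, norm_mul, absVal_inv, Complex.norm_real,
        Real.norm_of_nonneg (inv_nonneg.2 hq.le)]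
      gcongr
    have hconst : autocorrelation μ f 0 =
        ∫ s in U n, (absVal (ϖ ^ n)⁻¹ : ℂ) * autocorrelation μ f 0 ∂μ := by
      rw [setIntegral_const, Measure.real, hU, eAbs, ENNReal.toReal_ofReal hq.le, absVal_inv,
        Complex.real_smul, ← mul_assoc, ← Complex.ofReal_mul, mul_inv_cancel₀ hq.ne']
      simp
    have hUfin : μ (U n) < ∞ := by rw [hU]; exact (eAbs_ne_top _).lt_top
    have hi : IntegrableOn (fun s => (absVal (ϖ ^ n)⁻¹ : ℂ) * autocorrelation μ f s) (U n) μ :=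
      ((integrable_autocorrelation hf).const_mul _).integrableOn
    have hic : IntegrableOn (fun _ => (absVal (ϖ ^ n)⁻¹ : ℂ) * autocorrelation μ f 0) (U n) μ :=
      integrableOn_const hUfin.ne
    rw [hconst, dist_eq_norm, ← integral_sub hi hic]
    refine (norm_setIntegral_le_of_norm_le_const hUfin hclose).trans (le_of_eq ?_)
    rw [Measure.real, hU, eAbs, ENNReal.toReal_ofReal hq.le]
    field_simp
  have := (ENNReal.tendsto_ofReal hconv.norm)
  rwa [autocorrelation_zero hf2, Complex.norm_real, Real.norm_of_nonneg ENNReal.toReal_nonneg,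
    ENNReal.ofReal_toReal hL2] at this

end Plancherel

/-! ### Polarisation and approximation in `L²`. -/

section SquareIntegrable

variable {X Y : Type*} [MeasurableSpace X] [MeasurableSpace Y] {ν : Measure X} {ρ : Measure Y}

theorem norm_toLp_sq {f : X → ℂ} (hf : MemLp f 2 ν) :
    ‖hf.toLp f‖ ^ 2 = (∫⁻ x, ‖f x‖ₑ ^ 2 ∂ν).toReal := by
  rw [Lp.norm_toLp, ← ENNReal.toReal_pow, eLpNorm_two_sq]

theorem inner_toLp {f g : X → ℂ} (hf : MemLp f 2 ν) (hg : MemLp g 2 ν) :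
    inner ℂ (hg.toLp g) (hf.toLp f) = ∫ x, f x * conj (g x) ∂ν := by
  rw [L2.inner_def]
  refine integral_congr_ae ?_
  filter_upwards [hf.coeFn_toLp, hg.coeFn_toLp] with x h1 h2
  rw [h1, h2]
  simp [inner]

/-- Polarisation, with `c = ±1, ±I`. It serves twice: `k = 1` for Parseval's identity and `k = c_φ`
for the orthogonality relation of the wavelet transform. -/
theorem integral_mul_conj_eq_of_lintegral_eq {f₁ f₂ : X → ℂ} {F₁ F₂ : Y → ℂ}
    (hf₁ : MemLp f₁ 2 ν) (hf₂ : MemLp f₂ 2 ν) (hF₁ : MemLp F₁ 2 ρ) (hF₂ : MemLp F₂ 2 ρ) {k : ℝ≥0∞}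
    (h : ∀ c : ℂ, ∫⁻ y, ‖F₁ y + c * F₂ y‖ₑ ^ 2 ∂ρ = k * ∫⁻ x, ‖f₁ x + c * f₂ x‖ₑ ^ 2 ∂ν) :
    ∫ y, F₁ y * conj (F₂ y) ∂ρ = (k.toReal : ℂ) * ∫ x, f₁ x * conj (f₂ x) ∂ν := by
  have key : ∀ c : ℂ, ‖hF₁.toLp F₁ + c • hF₂.toLp F₂‖ ^ 2 =
      k.toReal * ‖hf₁.toLp f₁ + c • hf₂.toLp f₂‖ ^ 2 := by
    intro c
    have e1 : ‖hF₁.toLp F₁ + c • hF₂.toLp F₂‖ ^ 2 = (∫⁻ y, ‖F₁ y + c * F₂ y‖ₑ ^ 2 ∂ρ).toReal :=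
      norm_toLp_sq (hF₁.add (hF₂.const_smul c))
    have e2 : ‖hf₁.toLp f₁ + c • hf₂.toLp f₂‖ ^ 2 = (∫⁻ x, ‖f₁ x + c * f₂ x‖ₑ ^ 2 ∂ν).toReal :=
      norm_toLp_sq (hf₁.add (hf₂.const_smul c))
    rw [e1, e2, ← ENNReal.toReal_mul]
    exact congrArg _ (h c)
  have k1 := key 1
  have k2 := key (-1)
  have k3 := key Complex.I
  have k4 := key (-Complex.I)
  simp only [one_smul, neg_smul, ← sub_eq_add_neg] at k1 k2 k3 k4
  rw [← inner_toLp hF₁ hF₂, ← inner_toLp hf₁ hf₂, ← inner_conj_symm,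
    ← inner_conj_symm (hf₂.toLp f₂), inner_eq_sum_norm_sq_div_four,
    inner_eq_sum_norm_sq_div_four (hf₁.toLp f₁)]
  simp only [Complex.coe_algebraMap, RCLike.I_to_complex] at *
  have c1 : ((‖hF₁.toLp F₁ + hF₂.toLp F₂‖ : ℂ)) ^ 2 =
    (k.toReal : ℂ) * (‖hf₁.toLp f₁ + hf₂.toLp f₂‖ : ℂ) ^ 2 := by exact_mod_cast k1
  have c2 : ((‖hF₁.toLp F₁ - hF₂.toLp F₂‖ : ℂ)) ^ 2 =
    (k.toReal : ℂ) * (‖hf₁.toLp f₁ - hf₂.toLp f₂‖ : ℂ) ^ 2 := by exact_mod_cast k2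
  have c3 : ((‖hF₁.toLp F₁ + Complex.I • hF₂.toLp F₂‖ : ℂ)) ^ 2 =
    (k.toReal : ℂ) * (‖hf₁.toLp f₁ + Complex.I • hf₂.toLp f₂‖ : ℂ) ^ 2 := by exact_mod_cast k3
  have c4 : ((‖hF₁.toLp F₁ - Complex.I • hF₂.toLp F₂‖ : ℂ)) ^ 2 =
    (k.toReal : ℂ) * (‖hf₁.toLp f₁ - Complex.I • hf₂.toLp f₂‖ : ℂ) ^ 2 := by exact_mod_cast k4
  rw [c1, c2, c3, c4]
  simp only [map_div₀, map_add, map_sub, map_mul, map_pow, Complex.conj_ofReal, Complex.conj_I]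
  ring

theorem tendsto_eLpNorm_of_tendsto_sub {u : ℕ → X → ℂ} {f : X → ℂ} (hu : ∀ n, MemLp (u n) 2 ν)
    (hf : MemLp f 2 ν) (h : Tendsto (fun n => eLpNorm (u n - f) 2 ν) atTop (𝓝 0)) :
    Tendsto (fun n => eLpNorm (u n) 2 ν) atTop (𝓝 (eLpNorm f 2 ν)) := by
  have h1 := ((Lp.tendsto_Lp_iff_tendsto_eLpNorm'' u hu f hf).2 h).enorm
  simpa using h1

theorem exists_integrable_approx {f : X → ℂ} (hf : MemLp f 2 ν) :
    ∃ u : ℕ → X → ℂ, (∀ n, MemLp (u n) 1 ν ∧ MemLp (u n) 2 ν) ∧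
      Tendsto (fun n => eLpNorm (u n - f) 2 ν) atTop (𝓝 0) := by
  have h : ∀ n : ℕ, ∃ g : SimpleFunc X ℂ,
      eLpNorm (f - ⇑g) 2 ν < ENNReal.ofReal (1 / ((n : ℝ) + 1)) ∧ MemLp g 2 ν := fun n =>
    hf.exists_simpleFunc_eLpNorm_sub_lt ENNReal.ofNat_ne_top
      (ENNReal.ofReal_pos.2 (by positivity)).ne'
  choose g hg1 hg2 using h
  refine ⟨fun n => g n, fun n => ⟨?_, hg2 n⟩, ?_⟩
  · rw [memLp_one_iff_integrable]
    exact (SimpleFunc.memLp_iff_integrable two_ne_zero ENNReal.ofNat_ne_top).1 (hg2 n)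
  · refine tendsto_of_tendsto_of_tendsto_of_le_of_le tendsto_const_nhds
      (?_ : Tendsto (fun n : ℕ => ENNReal.ofReal (1 / ((n : ℝ) + 1))) atTop (𝓝 0))
      (fun n => zero_le) (fun n => ?_)
    · simpa using ENNReal.tendsto_ofReal tendsto_one_div_add_atTop_nhds_zero_nat
    · change eLpNorm (⇑(g n) - f) 2 ν ≤ _
      rw [eLpNorm_sub_comm]
      exact (hg1 n).le

end SquareIntegrable

/-! ### The Fourier transform on `L²`. -/

section L2Fourier

variable {K : Type*} [Field K] [ValuativeRel K] [TopologicalSpace K]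
  [IsNonarchimedeanLocalField K] [MeasurableSpace K] [BorelSpace K]
  {μ : Measure K} [μ.IsAddHaarMeasure] {e : AddChar K Circle}

theorem eLpNorm_fourierIntegral (hμ : μ {x : K | valuation K x ≤ 1} = 1)
    (he : IsFixedCharacter e) {f : K → ℂ} (hf : MemLp f 1 μ) (hf2 : MemLp f 2 μ) :
    eLpNorm (Fourier.fourierIntegral e μ f) 2 μ = eLpNorm f 2 μ := by
  have := lintegral_enorm_fourierIntegral_sq hμ he (memLp_one_iff_integrable.1 hf) hf2
  rw [← eLpNorm_two_sq, ← eLpNorm_two_sq] at this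
  exact (ENNReal.pow_right_strictMono two_ne_zero).injective this

theorem memLp_fourierIntegral (hμ : μ {x : K | valuation K x ≤ 1} = 1)
    (he : IsFixedCharacter e) {f : K → ℂ} (hf : MemLp f 1 μ) (hf2 : MemLp f 2 μ) :
    MemLp (Fourier.fourierIntegral e μ f) 2 μ :=
  ⟨(continuous_fourierIntegral he (memLp_one_iff_integrable.1 hf)).aestronglyMeasurable, by
    rw [eLpNorm_fourierIntegral hμ he hf hf2]; exact hf2.2⟩

theorem fourierIntegral_add_const_mul (he : IsFixedCharacter e) {f g : K → ℂ}
    (hf : MemLp f 1 μ) (hg : MemLp g 1 μ) (c : ℂ) :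
    Fourier.fourierIntegral e μ (f + c • g) =
      Fourier.fourierIntegral e μ f + c • Fourier.fourierIntegral e μ g := by
  rw [memLp_one_iff_integrable] at hf hg
  have := VectorFourier.fourierIntegral_add he.continuous (L := LinearMap.mul K K)
    (by simpa using continuous_mul) hf (hg.smul c)
  rw [VectorFourier.fourierIntegral_const_smul] at this
  exact this

theorem IsL2Fourier.add_const_smul (hμ : μ {x : K | valuation K x ≤ 1} = 1)
    (he : IsFixedCharacter e) {f F g G : K → ℂ} (hf : IsL2Fourier e μ f F)
    (hg : IsL2Fourier e μ g G) (c : ℂ) : IsL2Fourier e μ (f + c • g) (F + c • G) := by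
  obtain ⟨hf1, hF1, u, hu, hu1, hu2⟩ := hf
  obtain ⟨hg1, hG1, v, hv, hv1, hv2⟩ := hg
  have aux : ∀ {p q : ℕ → K → ℂ} {P Q : K → ℂ}, (∀ n, MemLp (p n) 2 μ) → (∀ n, MemLp (q n) 2 μ) →
      MemLp P 2 μ → MemLp Q 2 μ → Tendsto (fun n => eLpNorm (p n - P) 2 μ) atTop (𝓝 0) →
      Tendsto (fun n => eLpNorm (q n - Q) 2 μ) atTop (𝓝 0) →
      Tendsto (fun n => eLpNorm (p n + c • q n - (P + c • Q)) 2 μ) atTop (𝓝 0) := by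
    intro p q P Q hp hq hP hQ h1 h2
    have h3 : Tendsto (fun n => eLpNorm (p n - P) 2 μ + ‖c‖ₑ * eLpNorm (q n - Q) 2 μ) atTop
        (𝓝 (0 + ‖c‖ₑ * 0)) := h1.add (ENNReal.Tendsto.const_mul h2 (Or.inr enorm_ne_top))
    rw [mul_zero, add_zero] at h3
    refine tendsto_of_tendsto_of_tendsto_of_le_of_le tendsto_const_nhds h3
      (fun n => zero_le) fun n => ?_
    have h4 : p n + c • q n - (P + c • Q) = (p n - P) + c • (q n - Q) := by
      rw [smul_sub]; abel
    change eLpNorm (p n + c • q n - (P + c • Q)) 2 μ ≤ _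
    rw [h4, ← eLpNorm_const_smul]
    exact eLpNorm_add_le ((hp n).sub hP).1 (((hq n).sub hQ).const_smul c).1 one_le_two
  refine ⟨hf1.add (hg1.const_smul c), hF1.add (hG1.const_smul c), fun n => u n + c • v n,
    fun n => ⟨(hu n).1.add ((hv n).1.const_smul c), (hu n).2.add ((hv n).2.const_smul c)⟩,
    aux (fun n => (hu n).2) (fun n => (hv n).2) hf1 hg1 hu1 hv1, ?_⟩
  simp_rw [fourierIntegral_add_const_mul he (hu _).1 (hv _).1]
  exact aux (fun n => memLp_fourierIntegral hμ he (hu n).1 (hu n).2)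
    (fun n => memLp_fourierIntegral hμ he (hv n).1 (hv n).2) hF1 hG1 hu2 hv2

theorem IsL2Fourier.eLpNorm_eq (hμ : μ {x : K | valuation K x ≤ 1} = 1)
    (he : IsFixedCharacter e) {f F : K → ℂ} (hf : IsL2Fourier e μ f F) :
    eLpNorm F 2 μ = eLpNorm f 2 μ := by
  obtain ⟨hf1, hF1, u, hu, hu1, hu2⟩ := hf
  have h1 := tendsto_eLpNorm_of_tendsto_sub (fun n => (hu n).2) hf1 hu1
  have h2 := tendsto_eLpNorm_of_tendsto_sub
    (fun n => memLp_fourierIntegral hμ he (hu n).1 (hu n).2) hF1 hu2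
  simp_rw [eLpNorm_fourierIntegral hμ he (hu _).1 (hu _).2] at h2
  exact tendsto_nhds_unique h2 h1

/-- Parseval's identity. -/
theorem IsL2Fourier.integral_mul_conj (hμ : μ {x : K | valuation K x ≤ 1} = 1)
    (he : IsFixedCharacter e) {f F g G : K → ℂ} (hf : IsL2Fourier e μ f F)
    (hg : IsL2Fourier e μ g G) : ∫ x, f x * conj (g x) ∂μ = ∫ ξ, F ξ * conj (G ξ) ∂μ := by
  have := integral_mul_conj_eq_of_lintegral_eq hf.1 hg.1 hf.2.1 hg.2.1 (k := 1) fun c => by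
    have := (hf.add_const_smul hμ he hg c).eLpNorm_eq hμ he
    rw [one_mul]
    have h2 := congrArg (· ^ 2) this
    simp only [eLpNorm_two_sq] at h2
    exact h2
  simpa using this.symm

/-- Plancherel makes the transforms of an `L²` approximating sequence as Cauchy as the sequence
itself; completeness supplies the limit. -/
theorem exists_isL2Fourier (hμ : μ {x : K | valuation K x ≤ 1} = 1)
    (he : IsFixedCharacter e) {f : K → ℂ} (hf : MemLp f 2 μ) : ∃ F, IsL2Fourier e μ f F := by
  obtain ⟨u, hu, hu1⟩ := exists_integrable_approx hf
  have hF : ∀ n, MemLp (Fourier.fourierIntegral e μ (u n)) 2 μ := fun n =>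
    memLp_fourierIntegral hμ he (hu n).1 (hu n).2
  have hc : CauchySeq fun n => (hF n).toLp _ := by
    have h1 := ((Lp.tendsto_Lp_iff_tendsto_eLpNorm'' u (fun n => (hu n).2) f hf).2 hu1).cauchySeq
    rw [Metric.cauchySeq_iff] at h1 ⊢
    have hd : ∀ m n, dist ((hF m).toLp _) ((hF n).toLp _) =
        dist ((hu m).2.toLp _) ((hu n).2.toLp _) := by
      intro m n
      rw [dist_eq_norm, dist_eq_norm, ← MemLp.toLp_sub, ← MemLp.toLp_sub, Lp.norm_toLp,
        Lp.norm_toLp]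
      congr 1
      have h2 := fourierIntegral_add_const_mul he (hu m).1 (hu n).1 (-1)
      have h3 := eLpNorm_fourierIntegral hμ he ((hu m).1.add ((hu n).1.const_smul (-1 : ℂ)))
        ((hu m).2.add ((hu n).2.const_smul (-1 : ℂ)))
      rw [h2] at h3
      simpa [← sub_eq_add_neg] using h3
    simpa only [hd] using h1
  obtain ⟨F, hF'⟩ := cauchySeq_tendsto_of_complete hc
  refine ⟨F, hf, Lp.memLp F, u, hu, hu1, ?_⟩
  rw [← Lp.tendsto_Lp_iff_tendsto_eLpNorm'' _ hF _ (Lp.memLp F)]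
  simpa using hF'

theorem isL2Fourier_l2Fourier (hμ : μ {x : K | valuation K x ≤ 1} = 1)
    (he : IsFixedCharacter e) {f : K → ℂ} (hf : MemLp f 2 μ) :
    IsL2Fourier e μ f (l2Fourier e μ f) := by
  have h := exists_isL2Fourier hμ he hf
  rw [l2Fourier, dif_pos h]
  exact h.choose_spec

end L2Fourier

/-! ### Isometry of the wavelet transform. -/

section Wavelet

variable {K : Type*} [Field K] [ValuativeRel K] [TopologicalSpace K]
  [IsNonarchimedeanLocalField K] [MeasurableSpace K] [BorelSpace K]
  {μ : Measure K} [μ.IsAddHaarMeasure] {e : AddChar K Circle}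

instance : (𝓝[≠] (0 : K)).NeBot := by
  obtain ⟨ϖ, h0, h1⟩ := exists_valuation_lt_one K
  have : Tendsto (fun n : ℕ => ϖ ^ n) atTop (𝓝[≠] 0) :=
    tendsto_nhdsWithin_iff.2 ⟨tendsto_pow_zero h1, Eventually.of_forall fun n => pow_ne_zero n h0⟩
  exact this.neBot

theorem ae_ne_zero : ∀ᵐ a ∂μ, a ≠ 0 := Measure.ae_ne μ 0

theorem map_affine {a : K} (ha : a ≠ 0) (b : K) :
    μ.map (fun x => (x - b) / a) = eAbs a • μ := by
  have h1 : (fun x : K => (x - b) / a) = (fun x => a⁻¹ * x) ∘ fun x => x + -b := by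
    ext x; simp only [Function.comp]; ring
  rw [h1, ← Measure.map_map (measurable_const_mul _) (measurable_add_const _),
    map_add_right_eq_self, map_mul_left μ (inv_ne_zero ha), eAbs_inv ha, inv_inv]

theorem measurableEmbedding_affine {a : K} (ha : a ≠ 0) (b : K) :
    MeasurableEmbedding (fun x : K => (x - b) / a) := by
  have h := ((MeasurableEquiv.subRight b).trans
    (MeasurableEquiv.mulRight₀ a⁻¹ (inv_ne_zero ha))).measurableEmbedding
  simp only [div_eq_mul_inv]
  exact h

theorem quasiMeasurePreserving_affine {a : K} (ha : a ≠ 0) (b : K) :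
    Measure.QuasiMeasurePreserving (fun x => (x - b) / a) μ μ := by
  refine ⟨(measurableEmbedding_affine ha b).measurable, ?_⟩
  rw [map_affine ha]
  exact Measure.smul_absolutelyContinuous

theorem daughter_congr {ψ ψ' : K → ℂ} (h : ψ =ᵐ[μ] ψ') {a : K} (ha : a ≠ 0) (b : K) :
    daughter ψ a b =ᵐ[μ] daughter ψ' a b := by
  filter_upwards [(quasiMeasurePreserving_affine ha b).ae h] with x hx
  simp only [daughter, hx]

theorem memLp_daughter {ψ : K → ℂ} {p : ℝ≥0∞} (hψ : MemLp ψ p μ) {a : K} (ha : a ≠ 0) (b : K) :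
    MemLp (daughter ψ a b) p μ := by
  have h1 : MemLp ψ p (μ.map fun x => (x - b) / a) := by
    rw [map_affine ha]; exact hψ.smul_measure (eAbs_ne_top a)
  exact ((measurableEmbedding_affine ha b).memLp_map_measure_iff.1 h1).const_mul _

theorem enorm_inv_sqrt_sq {a : K} (ha : a ≠ 0) :
    ‖((1 / √(absVal a) : ℝ) : ℂ)‖ₑ ^ 2 = (eAbs a)⁻¹ := by
  have h := absVal_pos ha
  rw [← ofReal_norm, Complex.norm_real, Real.norm_of_nonneg (by positivity),
    ← ENNReal.ofReal_pow (by positivity), div_pow, Real.sq_sqrt h.le, one_pow, one_div,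
    ENNReal.ofReal_inv_of_pos h, eAbs]

theorem lintegral_enorm_daughter_sq (ψ : K → ℂ) {a : K} (ha : a ≠ 0) (b : K) :
    ∫⁻ x, ‖daughter ψ a b x‖ₑ ^ 2 ∂μ = ∫⁻ x, ‖ψ x‖ₑ ^ 2 ∂μ := by
  have h1 : ∀ x, ‖daughter ψ a b x‖ₑ ^ 2 = (eAbs a)⁻¹ * ‖ψ ((x - b) / a)‖ₑ ^ 2 := fun x => by
    rw [daughter, enorm_mul, mul_pow, enorm_inv_sqrt_sq ha]
  simp_rw [h1]
  rw [lintegral_const_mul' _ _ (ENNReal.inv_ne_top.2 (eAbs_ne_zero ha)),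
    ← (measurableEmbedding_affine ha b).lintegral_map (fun y => ‖ψ y‖ₑ ^ 2), map_affine ha,
    lintegral_smul_measure, smul_eq_mul, ← mul_assoc,
    ENNReal.inv_mul_cancel (eAbs_ne_zero ha) (eAbs_ne_top a), one_mul]

theorem eLpNorm_daughter (ψ : K → ℂ) {a : K} (ha : a ≠ 0) (b : K) :
    eLpNorm (daughter ψ a b) 2 μ = eLpNorm ψ 2 μ := by
  apply (ENNReal.pow_right_strictMono two_ne_zero).injective
  simp only [eLpNorm_two_sq]
  exact lintegral_enorm_daughter_sq ψ ha b

/-- The Fourier transform of `daughter ψ a b`, in terms of the Fourier transform `Ψ` of `ψ`. -/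
noncomputable def fourierDaughter (e : AddChar K Circle) (Ψ : K → ℂ) (a b ξ : K) : ℂ :=
  (√(absVal a) : ℂ) * (e (-(b * ξ)) : ℂ) * Ψ (a * ξ)

theorem fourierIntegral_daughter (ψ : K → ℂ) {a : K} (ha : a ≠ 0) (b : K) :
    Fourier.fourierIntegral e μ (daughter ψ a b) =
      fourierDaughter e (Fourier.fourierIntegral e μ ψ) a b := by
  ext ξ
  rw [fourierIntegral_apply, fourierDaughter, fourierIntegral_apply]
  have hp := absVal_pos ha
  have h1 : ∀ x, (e (-(x * ξ)) : ℂ) * daughter ψ a b x =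
      (((1 / √(absVal a) : ℝ) : ℂ) * (e (-(b * ξ)) : ℂ)) *
        (fun y => (e (-(y * (a * ξ))) : ℂ) * ψ y) ((x - b) / a) := by
    intro x
    have : (e (-(x * ξ)) : ℂ) = (e (-(b * ξ)) : ℂ) * (e (-((x - b) / a * (a * ξ))) : ℂ) := by
      rw [← Circle.coe_mul, ← e.map_add_eq_mul]
      congr 2
      field_simp
      ring
    rw [this, daughter]
    ring
  simp_rw [h1]
  rw [integral_const_mul, ← (measurableEmbedding_affine ha b).integral_map
    (fun y => (e (-(y * (a * ξ))) : ℂ) * ψ y), map_affine ha, integral_smul_measure, eAbs, ENNReal.toReal_ofReal hp.le, Complex.real_smul]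
  have h2 : ((1 / √(absVal a) : ℝ) : ℂ) * (absVal a : ℂ) = (√(absVal a) : ℂ) := by
    rw [← Complex.ofReal_mul]
    congr 1
    rw [one_div, inv_mul_eq_div, Real.div_sqrt]
  rw [← h2]
  ring

theorem enorm_sqrt_sq (a : K) : ‖(√(absVal a) : ℂ)‖ₑ ^ 2 = eAbs a := by
  rw [← ofReal_norm, Complex.norm_real, Real.norm_of_nonneg (by positivity),
    ← ENNReal.ofReal_pow (by positivity), Real.sq_sqrt (absVal_nonneg a), eAbs]

theorem eLpNorm_fourierDaughter (Ψ : K → ℂ) {a : K} (ha : a ≠ 0) (b : K) :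
    eLpNorm (fourierDaughter e Ψ a b) 2 μ = eLpNorm Ψ 2 μ := by
  apply (ENNReal.pow_right_strictMono two_ne_zero).injective
  simp only [eLpNorm_two_sq]
  have h1 : ∀ ξ, ‖fourierDaughter e Ψ a b ξ‖ₑ ^ 2 = eAbs a * ‖Ψ (a * ξ)‖ₑ ^ 2 := fun ξ => by
    rw [fourierDaughter, enorm_mul, enorm_mul, mul_pow, mul_pow, enorm_sqrt_sq,
      ← ofReal_norm (e _ : ℂ), Circle.norm_coe]
    simp
  simp_rw [h1]
  rw [lintegral_const_mul' _ _ (eAbs_ne_top a), lintegral_mul_left μ ha fun ξ => ‖Ψ ξ‖ₑ ^ 2,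
    ← mul_assoc, ENNReal.mul_inv_cancel (eAbs_ne_zero ha) (eAbs_ne_top a), one_mul]

theorem memLp_fourierDaughter (he : IsFixedCharacter e) {Ψ : K → ℂ} (hΨ : MemLp Ψ 2 μ) {a : K}
    (ha : a ≠ 0) (b : K) : MemLp (fourierDaughter e Ψ a b) 2 μ := by
  refine ⟨?_, by rw [eLpNorm_fourierDaughter Ψ ha]; exact hΨ.2⟩
  refine AEStronglyMeasurable.mul ?_
    (hΨ.1.comp_quasiMeasurePreserving (quasiMeasurePreserving_mul_left μ ha))
  exact (((measurable_character he (by fun_prop)).const_mul _)).aestronglyMeasurable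

/-- Dilation with translation, and its Fourier counterpart, are both `L²` isometries, so
approximating sequences are carried along. -/
theorem isL2Fourier_daughter (he : IsFixedCharacter e)
    {ψ Ψ : K → ℂ} (h : IsL2Fourier e μ ψ Ψ) {a : K} (ha : a ≠ 0) (b : K) :
    IsL2Fourier e μ (daughter ψ a b) (fourierDaughter e Ψ a b) := by
  obtain ⟨h1, h2, u, hu, hu1, hu2⟩ := h
  refine ⟨memLp_daughter h1 ha b, memLp_fourierDaughter he h2 ha b, fun n => daughter (u n) a b,
    fun n => ⟨memLp_daughter (hu n).1 ha b, memLp_daughter (hu n).2 ha b⟩, ?_, ?_⟩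
  · refine hu1.congr fun n => ?_
    rw [← eLpNorm_daughter _ ha b]
    congr 1
    ext x
    simp only [daughter, Pi.sub_apply, mul_sub]
  · refine hu2.congr fun n => ?_
    rw [← eLpNorm_fourierDaughter (e := e) _ ha b, fourierIntegral_daughter _ ha]
    congr 1
    ext x
    simp only [fourierDaughter, Pi.sub_apply, mul_sub]

/-- The affine invariant measure `|a|⁻² da db`. -/
noncomputable def affineMeasure (μ : Measure K) : Measure (K × K) :=
  (μ.withDensity fun a => (eAbs a)⁻¹ ^ 2).prod μ

instance : SFinite (affineMeasure μ) := by unfold affineMeasure; infer_instance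

theorem measurable_eAbs (hμ : μ {x : K | valuation K x ≤ 1} = 1) :
    Measurable (eAbs : K → ℝ≥0∞) := (measurable_absVal hμ).ennreal_ofReal

theorem lintegral_affineMeasure (hμ : μ {x : K | valuation K x ≤ 1} = 1) {f : K × K → ℝ≥0∞}
    (hf : Measurable f) :
    ∫⁻ q, f q ∂(affineMeasure μ) = ∫⁻ a, (eAbs a)⁻¹ ^ 2 * ∫⁻ b, f (a, b) ∂μ ∂μ := by
  have hw : Measurable fun a : K => (eAbs a)⁻¹ ^ 2 := (measurable_eAbs hμ).inv.pow_const 2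
  rw [affineMeasure, lintegral_prod _ hf.aemeasurable,
    lintegral_withDensity_eq_lintegral_mul _ hw hf.lintegral_prod_right']
  rfl

/-- The slice `a = 0`, where daughters take default values and the weight is infinite, is null. -/
theorem ae_affineMeasure_ne_zero : ∀ᵐ q ∂(affineMeasure μ), q.1 ≠ 0 := by
  have h : ∀ᵐ a ∂(μ.withDensity fun a => (eAbs a)⁻¹ ^ 2), a ≠ 0 :=
    (withDensity_absolutelyContinuous μ _).ae_le ae_ne_zero
  exact Measure.quasiMeasurePreserving_fst.ae h

theorem measurable_daughter (hμ : μ {x : K | valuation K x ≤ 1} = 1) {ψ : K → ℂ}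
    (hψ : Measurable ψ) : Measurable fun q : (K × K) × K => daughter ψ q.1.1 q.1.2 q.2 := by
  have h1 := measurable_absVal hμ
  unfold daughter
  have h2 : Measurable fun q : (K × K) × K => (q.2 - q.1.2) / q.1.1 := by fun_prop
  have h3 : Measurable fun q : (K × K) × K => ((1 / √(absVal q.1.1) : ℝ) : ℂ) := by fun_prop
  exact h3.mul (hψ.comp h2)

theorem cwt_congr_right {ψ f g : K → ℂ} (h : f =ᵐ[μ] g) (a b : K) :
    cwt μ ψ f a b = cwt μ ψ g a b := by
  refine integral_congr_ae ?_
  filter_upwards [h] with x hx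
  rw [hx]

theorem cwt_congr_left {ψ ψ' f : K → ℂ} (h : ψ =ᵐ[μ] ψ') {a : K} (ha : a ≠ 0) (b : K) :
    cwt μ ψ f a b = cwt μ ψ' f a b := by
  refine integral_congr_ae ?_
  filter_upwards [daughter_congr h ha b] with x hx
  rw [hx]

theorem measurable_cwt (hμ : μ {x : K | valuation K x ≤ 1} = 1) {ψ f : K → ℂ}
    (hψ : Measurable ψ) (hf : AEStronglyMeasurable f μ) :
    Measurable fun q : K × K => cwt μ ψ f q.1 q.2 := by
  have h1 : Measurable fun q : (K × K) × K =>
      hf.mk f q.2 * conj (daughter ψ q.1.1 q.1.2 q.2) :=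
    (hf.stronglyMeasurable_mk.measurable.comp measurable_snd).mul
      (Complex.continuous_conj.measurable.comp (measurable_daughter hμ hψ))
  have h2 := h1.stronglyMeasurable.integral_prod_right' (ν := μ)
  simp_rw [cwt_congr_right hf.ae_eq_mk]
  exact h2.measurable

theorem norm_cwt_le {ψ f : K → ℂ} (hψ : MemLp ψ 2 μ) (hf : MemLp f 2 μ) {a : K} (ha : a ≠ 0)
    (b : K) : ‖cwt μ ψ f a b‖ ≤ (eLpNorm f 2 μ).toReal * (eLpNorm ψ 2 μ).toReal := by
  have h := memLp_daughter hψ ha b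
  refine (norm_integral_mul_le hf (memLp_conj h)).trans (le_of_eq ?_)
  rw [← eLpNorm_daughter ψ ha b]
  congr 2
  exact eLpNorm_congr_norm_ae (ae_of_all _ fun x => by simp)

/-- By Parseval, for fixed `a` the conjugate of the transform is, as a function of `b`, a Fourier
integral. Plancherel can then be applied in `b`. -/
theorem enorm_cwt_eq (hμ : μ {x : K | valuation K x ≤ 1} = 1) (he : IsFixedCharacter e)
    {ψ Ψ f F : K → ℂ} (hψ : IsL2Fourier e μ ψ Ψ) (hf : IsL2Fourier e μ f F) {a : K} (ha : a ≠ 0)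
    (b : K) : ‖cwt μ ψ f a b‖ₑ =
      ‖Fourier.fourierIntegral e μ (fun ξ => (√(absVal a) : ℂ) * Ψ (a * ξ) * conj (F ξ)) b‖ₑ := by
  have h1 : cwt μ ψ f a b = ∫ ξ, F ξ * conj (fourierDaughter e Ψ a b ξ) ∂μ :=
    hf.integral_mul_conj hμ he (isL2Fourier_daughter he hψ ha b)
  have h2 : conj (cwt μ ψ f a b) = Fourier.fourierIntegral e μ
      (fun ξ => (√(absVal a) : ℂ) * Ψ (a * ξ) * conj (F ξ)) b := by
    rw [h1, ← integral_conj, fourierIntegral_apply]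
    refine integral_congr_ae (ae_of_all _ fun ξ => ?_)
    simp only [map_mul, Complex.conj_conj, fourierDaughter]
    rw [mul_comm b ξ]
    ring
  rw [← h2, ← ofReal_norm, ← ofReal_norm, Complex.norm_conj]

/-- The wavelet transform is an isometry up to the admissibility constant. -/
theorem lintegral_enorm_cwt_sq (hμ : μ {x : K | valuation K x ≤ 1} = 1) (he : IsFixedCharacter e)
    {ψ Ψ f : K → ℂ} (hψm : Measurable ψ) (hΨm : Measurable Ψ) (hψ : IsL2Fourier e μ ψ Ψ)
    (hc : ∫⁻ ξ, ‖Ψ ξ‖ₑ ^ 2 / eAbs ξ ∂μ ≠ ∞) (hf : MemLp f 2 μ) :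
    ∫⁻ q, ‖cwt μ ψ f q.1 q.2‖ₑ ^ 2 ∂(affineMeasure μ) =
      (∫⁻ ξ, ‖Ψ ξ‖ₑ ^ 2 / eAbs ξ ∂μ) * ∫⁻ x, ‖f x‖ₑ ^ 2 ∂μ := by
  obtain ⟨F₀, hF₀⟩ := exists_isL2Fourier hμ he hf
  obtain ⟨F, hFm, hF⟩ : ∃ F, Measurable F ∧ IsL2Fourier e μ f F := by
    refine ⟨hF₀.2.1.1.mk, hF₀.2.1.1.stronglyMeasurable_mk.measurable, hf,
      hF₀.2.1.ae_eq hF₀.2.1.1.ae_eq_mk, ?_⟩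
    obtain ⟨u, hu, hu1, hu2⟩ := hF₀.2.2
    refine ⟨u, hu, hu1, hu2.congr fun n => eLpNorm_congr_ae ?_⟩
    filter_upwards [hF₀.2.1.1.ae_eq_mk] with x hx
    rw [Pi.sub_apply, Pi.sub_apply, hx]
  have hAm := measurable_eAbs (μ := μ) hμ
  set C := ∫⁻ ξ, ‖Ψ ξ‖ₑ ^ 2 / eAbs ξ ∂μ with hC
  have hF2 : ∫⁻ ξ, ‖F ξ‖ₑ ^ 2 ∂μ = ∫⁻ x, ‖f x‖ₑ ^ 2 ∂μ := by
    rw [← eLpNorm_two_sq, ← eLpNorm_two_sq, hF.eLpNorm_eq hμ he]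
  let P : K → K → ℝ≥0∞ := fun a ξ => ‖F ξ‖ₑ ^ 2 * (‖Ψ (a * ξ)‖ₑ ^ 2 / eAbs a)
  have hPm : Measurable (Function.uncurry P) := by
    have h1 : Measurable fun q : K × K => q.1 * q.2 := by fun_prop
    exact ((hFm.enorm.pow_const 2).comp measurable_snd).mul
      (((hΨm.enorm.pow_const 2).comp h1).div (hAm.comp measurable_fst))
  -- Invariance of `da / |a|` under `a ↦ a ξ` is what makes the admissibility constant appear,
  -- independently of `ξ`.
  have hscale : ∀ ξ, ξ ≠ 0 → ∫⁻ a, ‖Ψ (a * ξ)‖ₑ ^ 2 / eAbs a ∂μ = C := by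
    intro ξ hξ
    have h1 : ∀ a, ‖Ψ (a * ξ)‖ₑ ^ 2 / eAbs a =
        eAbs ξ * (fun t => ‖Ψ t‖ₑ ^ 2 / eAbs t) (ξ * a) := by
      intro a
      simp only
      rw [eAbs_mul, mul_comm a ξ, div_eq_mul_inv, div_eq_mul_inv, ENNReal.mul_inv
        (Or.inl (eAbs_ne_zero hξ)) (Or.inl (eAbs_ne_top ξ))]
      calc _ = (eAbs ξ * (eAbs ξ)⁻¹) * (‖Ψ (ξ * a)‖ₑ ^ 2 * (eAbs a)⁻¹) := by
            rw [ENNReal.mul_inv_cancel (eAbs_ne_zero hξ) (eAbs_ne_top ξ), one_mul]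
        _ = _ := by ring
    simp_rw [h1]
    rw [lintegral_const_mul' _ _ (eAbs_ne_top ξ), lintegral_mul_left μ hξ fun t => ‖Ψ t‖ₑ ^ 2 / eAbs t, ← mul_assoc,
      ENNReal.mul_inv_cancel (eAbs_ne_zero hξ) (eAbs_ne_top ξ), one_mul]
  have htot : ∫⁻ a, ∫⁻ ξ, P a ξ ∂μ ∂μ = C * ∫⁻ x, ‖f x‖ₑ ^ 2 ∂μ := by
    rw [lintegral_lintegral_swap hPm.aemeasurable, ← hF2,
      ← lintegral_const_mul _ (hFm.enorm.pow_const 2)]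
    refine lintegral_congr_ae ?_
    filter_upwards [ae_ne_zero (μ := μ)] with ξ hξ
    have hm : Measurable fun a => ‖Ψ (a * ξ)‖ₑ ^ 2 / eAbs a :=
      ((hΨm.enorm.pow_const 2).comp (measurable_mul_const ξ)).div hAm
    simp only [P]
    rw [lintegral_const_mul _ hm, hscale ξ hξ, mul_comm]
  -- Needed so that, for almost every `a`, the function `G` below is square integrable. It is
  -- integrable in any case, as a product of two `L²` functions.
  have hfin : ∀ᵐ a ∂μ, ∫⁻ ξ, P a ξ ∂μ < ∞ := by
    refine ae_lt_top hPm.lintegral_prod_right ?_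
    rw [htot]
    refine ENNReal.mul_ne_top hc ?_
    rw [← eLpNorm_two_sq]
    exact ENNReal.pow_ne_top hf.2.ne
  rw [lintegral_affineMeasure hμ ((measurable_cwt hμ hψm hf.1).enorm.pow_const 2), ← htot]
  refine lintegral_congr_ae ?_
  filter_upwards [hfin, ae_ne_zero (μ := μ)] with a hafin ha
  simp only [enorm_cwt_eq hμ he hψ hF ha]
  let G : K → ℂ := fun ξ => (√(absVal a) : ℂ) * Ψ (a * ξ) * conj (F ξ)
  have hGe : ∀ ξ, ‖G ξ‖ₑ ^ 2 = eAbs a ^ 2 * P a ξ := by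
    intro ξ
    have hcj : ‖conj (F ξ)‖ₑ = ‖F ξ‖ₑ := by
      rw [← ofReal_norm, ← ofReal_norm, Complex.norm_conj]
    simp only [G, P]
    rw [enorm_mul, enorm_mul, mul_pow, mul_pow, enorm_sqrt_sq, hcj, div_eq_mul_inv]
    calc _ = (eAbs a * (eAbs a)⁻¹) * (eAbs a * (‖Ψ (a * ξ)‖ₑ ^ 2 * ‖F ξ‖ₑ ^ 2)) := by
          rw [ENNReal.mul_inv_cancel (eAbs_ne_zero ha) (eAbs_ne_top a), one_mul, mul_assoc]
      _ = _ := by ring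
  have hΨa : MemLp (fun ξ => (√(absVal a) : ℂ) * Ψ (a * ξ)) 2 μ := by
    refine (memLp_congr_ae (ae_of_all _ fun ξ => ?_)).1 (memLp_fourierDaughter he hψ.2.1 ha 0)
    simp [fourierDaughter]
  have hGi : Integrable G μ := hΨa.integrable_mul (memLp_conj hF.2.1)
  have hG2 : ∫⁻ ξ, ‖G ξ‖ₑ ^ 2 ∂μ = eAbs a ^ 2 * ∫⁻ ξ, P a ξ ∂μ := by
    simp_rw [hGe]
    rw [lintegral_const_mul' _ _ (ENNReal.pow_ne_top (eAbs_ne_top a))]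
  have hGL : MemLp G 2 μ := by
    refine ⟨hGi.1, ?_⟩
    have : eLpNorm G 2 μ ^ 2 < ∞ := by
      rw [eLpNorm_two_sq, hG2]
      exact ENNReal.mul_lt_top (ENNReal.pow_lt_top (eAbs_ne_top a).lt_top) hafin
    exact (ENNReal.pow_lt_top_iff.1 this).resolve_right two_ne_zero
  rw [lintegral_enorm_fourierIntegral_sq hμ he hGi hGL, hG2, ← mul_assoc, ← mul_pow,
    ENNReal.inv_mul_cancel (eAbs_ne_zero ha) (eAbs_ne_top a), one_pow, one_mul]

theorem memLp_two_of_lintegral_ne_top {X : Type*} [MeasurableSpace X] {ν : Measure X} {f : X → ℂ}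
    (hf : AEStronglyMeasurable f ν) (h : ∫⁻ x, ‖f x‖ₑ ^ 2 ∂ν ≠ ∞) : MemLp f 2 ν := by
  refine ⟨hf, ?_⟩
  rw [← eLpNorm_two_sq] at h
  exact (ENNReal.pow_lt_top_iff.1 h.lt_top).resolve_right two_ne_zero

theorem lintegral_enorm_sq_ne_top {X : Type*} [MeasurableSpace X] {ν : Measure X} {f : X → ℂ}
    (hf : MemLp f 2 ν) : ∫⁻ x, ‖f x‖ₑ ^ 2 ∂ν ≠ ∞ := by
  rw [← eLpNorm_two_sq]
  exact ENNReal.pow_ne_top hf.2.ne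

theorem memLp_cwt (hμ : μ {x : K | valuation K x ≤ 1} = 1) (he : IsFixedCharacter e)
    {ψ Ψ f : K → ℂ} (hψm : Measurable ψ) (hΨm : Measurable Ψ) (hψ : IsL2Fourier e μ ψ Ψ)
    (hc : ∫⁻ ξ, ‖Ψ ξ‖ₑ ^ 2 / eAbs ξ ∂μ ≠ ∞) (hf : MemLp f 2 μ) :
    MemLp (fun q : K × K => cwt μ ψ f q.1 q.2) 2 (affineMeasure μ) := by
  refine memLp_two_of_lintegral_ne_top (measurable_cwt hμ hψm hf.1).aestronglyMeasurable ?_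
  rw [lintegral_enorm_cwt_sq hμ he hψm hΨm hψ hc hf]
  exact ENNReal.mul_ne_top hc (lintegral_enorm_sq_ne_top hf)

theorem cwt_add_const_mul {ψ f g : K → ℂ} (hψ : MemLp ψ 2 μ) (hf : MemLp f 2 μ) (hg : MemLp g 2 μ)
    (c : ℂ) {a : K} (ha : a ≠ 0) (b : K) :
    cwt μ ψ (fun x => f x + c * g x) a b = cwt μ ψ f a b + c * cwt μ ψ g a b := by
  have h := memLp_conj (memLp_daughter hψ ha b)
  have hi1 : Integrable (fun x => f x * conj (daughter ψ a b x)) μ := hf.integrable_mul h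
  have hi2 : Integrable (fun x => g x * conj (daughter ψ a b x)) μ := hg.integrable_mul h
  rw [cwt, cwt, cwt, ← integral_const_mul, ← integral_add hi1 (hi2.const_mul c)]
  refine integral_congr_ae (ae_of_all _ fun x => ?_)
  simp only
  ring

theorem integral_cwt_mul_conj (hμ : μ {x : K | valuation K x ≤ 1} = 1) (he : IsFixedCharacter e)
    {ψ Ψ f g : K → ℂ} (hψm : Measurable ψ) (hΨm : Measurable Ψ) (hψ : IsL2Fourier e μ ψ Ψ)
    (hc : ∫⁻ ξ, ‖Ψ ξ‖ₑ ^ 2 / eAbs ξ ∂μ ≠ ∞) (hf : MemLp f 2 μ) (hg : MemLp g 2 μ) :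
    ∫ q, cwt μ ψ f q.1 q.2 * conj (cwt μ ψ g q.1 q.2) ∂(affineMeasure μ) =
      ((∫⁻ ξ, ‖Ψ ξ‖ₑ ^ 2 / eAbs ξ ∂μ).toReal : ℂ) * ∫ x, f x * conj (g x) ∂μ := by
  refine integral_mul_conj_eq_of_lintegral_eq hf hg (memLp_cwt hμ he hψm hΨm hψ hc hf)
    (memLp_cwt hμ he hψm hΨm hψ hc hg) fun c => ?_
  have key := lintegral_enorm_cwt_sq hμ he hψm hΨm hψ hc (hf.add (hg.const_mul c))
  simp only [Pi.add_apply] at key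
  rw [← key]
  refine lintegral_congr_ae ?_
  filter_upwards [ae_affineMeasure_ne_zero (μ := μ)] with q hq
  have := cwt_add_const_mul hψ.1 hf hg c hq q.2
  rw [← this]
  rfl

/-- An admissible wavelet and its Fourier transform have measurable representatives. -/
theorem IsAdmissibleWavelet.exists_measurable (hμ : μ {x : K | valuation K x ≤ 1} = 1)
    (he : IsFixedCharacter e) {ψ : K → ℂ} (h : IsAdmissibleWavelet e μ ψ) :
    ∃ ψ' Ψ : K → ℂ, Measurable ψ' ∧ Measurable Ψ ∧ ψ =ᵐ[μ] ψ' ∧ IsL2Fourier e μ ψ' Ψ ∧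
      ∫⁻ ξ, ‖Ψ ξ‖ₑ ^ 2 / eAbs ξ ∂μ = admissibilityConstant e μ ψ := by
  have h1 := isL2Fourier_l2Fourier hμ he h.1
  have e1 := h.1.1.ae_eq_mk
  have e2 := h1.2.1.1.ae_eq_mk
  refine ⟨_, _, h.1.1.stronglyMeasurable_mk.measurable, h1.2.1.1.stronglyMeasurable_mk.measurable,
    e1, ⟨h.1.ae_eq e1, h1.2.1.ae_eq e2, ?_⟩, ?_⟩
  · obtain ⟨u, hu, hu1, hu2⟩ := h1.2.2
    refine ⟨u, hu, hu1.congr fun n => eLpNorm_congr_ae ?_, hu2.congr fun n => eLpNorm_congr_ae ?_⟩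
    · filter_upwards [e1] with x hx
      rw [Pi.sub_apply, Pi.sub_apply, hx]
    · filter_upwards [e2] with x hx
      rw [Pi.sub_apply, Pi.sub_apply, hx]
  · refine lintegral_congr_ae ?_
    filter_upwards [e2] with x hx
    rw [← hx, eAbs]

end Wavelet

/-! ### The wavelet kernel, its homogeneity, and the trilinear form. -/

section Kernel

variable {K : Type*} [Field K] [ValuativeRel K] [TopologicalSpace K]
  [IsNonarchimedeanLocalField K] [MeasurableSpace K] [BorelSpace K]
  {μ : Measure K} [μ.IsAddHaarMeasure] {e : AddChar K Circle}

/-- The kernel `conj ψ_{a,b}(z) conj χ_{a,b}(y)` at `q = (a, b)` and `p = (y, z)`. -/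
noncomputable def waveletKernel (ψ χ : K → ℂ) (q p : K × K) : ℂ :=
  conj (daughter ψ q.1 q.2 p.2) * conj (daughter χ q.1 q.2 p.1)

/-- The function of `p = (y, z)` whose wavelet transform is `H`, tested against the kernel. -/
noncomputable def synthesis (μ : Measure K) (ψ χ : K → ℂ) (H : K × K → ℂ) (p : K × K) : ℂ :=
  ∫ q, waveletKernel ψ χ q p * H q ∂(affineMeasure μ)

/-- The trilinear form `∫ (K_ψ h)(a,b) (K_χ g)(a,b) H(a,b) da db / |a|²`. -/
noncomputable def waveletForm (μ : Measure K) (ψ χ : K → ℂ) (H : K × K → ℂ) (h g : K → ℂ) : ℂ :=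
  ∫ q, cwt μ ψ h q.1 q.2 * cwt μ χ g q.1 q.2 * H q ∂(affineMeasure μ)

theorem measurable_waveletKernel (hμ : μ {x : K | valuation K x ≤ 1} = 1) {ψ χ : K → ℂ}
    (hψ : Measurable ψ) (hχ : Measurable χ) :
    Measurable fun r : (K × K) × (K × K) => waveletKernel ψ χ r.1 r.2 := by
  have hc := Complex.continuous_conj.measurable
  have h1 : Measurable fun r : (K × K) × (K × K) => (r.1, r.2.2) := by fun_prop
  have h2 : Measurable fun r : (K × K) × (K × K) => (r.1, r.2.1) := by fun_prop
  exact (hc.comp ((measurable_daughter hμ hψ).comp h1)).mul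
    (hc.comp ((measurable_daughter hμ hχ).comp h2))

theorem daughter_affine (ψ : K → ℂ) {l : K} (hl : l ≠ 0) (a b t z : K) :
    daughter ψ (l * a) (z + l * b) (z + l * t) =
      ((1 / √(absVal l) : ℝ) : ℂ) * daughter ψ a b t := by
  have h1 : (z + l * t - (z + l * b)) / (l * a) = (t - b) / a := by
    rw [add_sub_add_left_eq_sub, ← mul_sub, mul_div_mul_left _ _ hl]
  rw [daughter, daughter, h1, absVal_mul, Real.sqrt_mul (absVal_nonneg l), ← mul_assoc,
    ← Complex.ofReal_mul, one_div_mul_one_div]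

/-- This is left invariance of Haar measure on the affine group: the changes of variable in `a` and
`b` each give `|l|⁻¹`, and the weight `|a|⁻²` gives `|l|²`. -/
theorem lintegral_affineMeasure_affine (hμ : μ {x : K | valuation K x ≤ 1} = 1)
    {f : K × K → ℝ≥0∞} (hf : Measurable f) {l : K} (hl : l ≠ 0) (z : K) :
    ∫⁻ q, f (l * q.1, z + l * q.2) ∂(affineMeasure μ) = ∫⁻ q, f q ∂(affineMeasure μ) := by
  have hA := measurable_eAbs (μ := μ) hμ
  have h0 := eAbs_ne_zero hl
  have ht := eAbs_ne_top l
  have hsub : Measurable fun q : K × K => (l * q.1, z + l * q.2) := by fun_prop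
  have hfs : Measurable fun q : K × K => f (l * q.1, z + l * q.2) := hf.comp hsub
  rw [lintegral_affineMeasure hμ hf, lintegral_affineMeasure hμ hfs]
  have h1 : ∀ a, (eAbs a)⁻¹ ^ 2 * ∫⁻ b, f (l * a, z + l * b) ∂μ =
      eAbs l * (fun t => (eAbs t)⁻¹ ^ 2 * ∫⁻ b, f (t, b) ∂μ) (l * a) := by
    intro a
    simp only
    rw [lintegral_mul_left μ hl (fun b => f (l * a, z + b)),
      lintegral_add_left_eq_self (μ := μ) (fun b => f (l * a, b)) z, eAbs_mul,
      ENNReal.mul_inv (Or.inl h0) (Or.inl ht)]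
    calc _ = (eAbs l)⁻¹ * ((eAbs a)⁻¹ ^ 2 * ∫⁻ b, f (l * a, b) ∂μ) := by ring
      _ = (eAbs l * (eAbs l)⁻¹) * ((eAbs l)⁻¹ * ((eAbs a)⁻¹ ^ 2 * ∫⁻ b, f (l * a, b) ∂μ)) := by
          rw [ENNReal.mul_inv_cancel h0 ht, one_mul]
      _ = _ := by ring
  simp_rw [h1]
  rw [lintegral_const_mul' _ _ ht,
    lintegral_mul_left μ hl fun t => (eAbs t)⁻¹ ^ 2 * ∫⁻ b, f (t, b) ∂μ, ← mul_assoc,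
    ENNReal.mul_inv_cancel h0 ht, one_mul]

/-- The affine map `t ↦ z + (y - z) t` sends `(1, 0)` to `(y, z)` and acts on `(a, b)` preserving
the invariant measure. Each of the two daughters contributes a factor `|y - z|⁻¹` to the square. -/
theorem lintegral_enorm_waveletKernel_sq (hμ : μ {x : K | valuation K x ≤ 1} = 1) {ψ χ : K → ℂ}
    (hψ : Measurable ψ) (hχ : Measurable χ) {y z : K} (hyz : y ≠ z) :
    ∫⁻ q, ‖waveletKernel ψ χ q (y, z)‖ₑ ^ 2 ∂(affineMeasure μ) =
      (eAbs (y - z))⁻¹ ^ 2 * ∫⁻ q, ‖waveletKernel ψ χ q (1, 0)‖ₑ ^ 2 ∂(affineMeasure μ) := by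
  have hl : y - z ≠ 0 := sub_ne_zero.2 hyz
  have hm : Measurable fun q : K × K => ‖waveletKernel ψ χ q (y, z)‖ₑ ^ 2 :=
    (((measurable_waveletKernel hμ hψ hχ).comp
      (measurable_id.prodMk measurable_const)).enorm.pow_const 2)
  rw [← lintegral_affineMeasure_affine hμ hm hl z, ← lintegral_const_mul' _ _
    (ENNReal.pow_ne_top (ENNReal.inv_ne_top.2 (eAbs_ne_zero hl)))]
  refine lintegral_congr fun q => ?_
  have h1 := daughter_affine ψ hl q.1 q.2 0 z
  have h2 := daughter_affine χ hl q.1 q.2 1 z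
  rw [mul_zero, add_zero] at h1
  rw [mul_one, add_sub_cancel] at h2
  have hce : ∀ w : ℂ, ‖conj w‖ₑ = ‖w‖ₑ := fun w => by
    rw [← ofReal_norm, ← ofReal_norm, Complex.norm_conj]
  simp only [waveletKernel, h1, h2, enorm_mul, hce, mul_pow, enorm_inv_sqrt_sq hl]
  ring

/-- One factor is square integrable and the other is bounded by Cauchy–Schwarz, so `χ` enters only
through its `L²` norm. -/
theorem memLp_cwt_mul_cwt {ψ χ : K → ℂ} (hμ : μ {x : K | valuation K x ≤ 1} = 1)
    (hχm : Measurable χ) (hχ : MemLp χ 2 μ) {h g : K → ℂ} (hg : MemLp g 2 μ)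
    (hψh : MemLp (fun q : K × K => cwt μ ψ h q.1 q.2) 2 (affineMeasure μ)) :
    MemLp (fun q : K × K => cwt μ ψ h q.1 q.2 * cwt μ χ g q.1 q.2) 2 (affineMeasure μ) ∧
    eLpNorm (fun q : K × K => cwt μ ψ h q.1 q.2 * cwt μ χ g q.1 q.2) 2 (affineMeasure μ) ≤
      eLpNorm g 2 μ * eLpNorm χ 2 μ *
        eLpNorm (fun q : K × K => cwt μ ψ h q.1 q.2) 2 (affineMeasure μ) := by
  have hb : ∀ᵐ q ∂(affineMeasure μ), ‖cwt μ ψ h q.1 q.2 * cwt μ χ g q.1 q.2‖ ≤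
      (eLpNorm g 2 μ).toReal * (eLpNorm χ 2 μ).toReal * ‖cwt μ ψ h q.1 q.2‖ := by
    filter_upwards [ae_affineMeasure_ne_zero (μ := μ)] with q hq
    rw [norm_mul, mul_comm]
    exact mul_le_mul_of_nonneg_right (norm_cwt_le hχ hg hq q.2) (norm_nonneg _)
  refine ⟨hψh.of_le_mul (hψh.1.mul (measurable_cwt hμ hχm hg.1).aestronglyMeasurable) hb, ?_⟩
  refine (eLpNorm_le_mul_eLpNorm_of_ae_le_mul hb 2).trans (le_of_eq ?_)
  rw [ENNReal.ofReal_mul ENNReal.toReal_nonneg, ENNReal.ofReal_toReal hg.2.ne,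
    ENNReal.ofReal_toReal hχ.2.ne]

/-- For fixed `q` the integrand is a product in `y` and `z`, and Cauchy–Schwarz bounds its `L¹` norm
by a constant independent of `q`, times `‖G q‖`. Integrability of `G` is what licenses Fubini here.
-/
theorem integrable_waveletKernel_mul (hμ : μ {x : K | valuation K x ≤ 1} = 1) {ψ χ : K → ℂ}
    (hψm : Measurable ψ) (hχm : Measurable χ) (hψ : MemLp ψ 2 μ) (hχ : MemLp χ 2 μ)
    {G : K × K → ℂ} (hG : Integrable G (affineMeasure μ)) {h g : K → ℂ} (hh : MemLp h 2 μ)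
    (hg : MemLp g 2 μ) :
    Integrable (fun r : (K × K) × (K × K) => waveletKernel ψ χ r.1 r.2 * G r.1 *
      (g r.2.1 * h r.2.2)) ((affineMeasure μ).prod (μ.prod μ)) := by
  have hm : AEStronglyMeasurable (fun r : (K × K) × (K × K) => waveletKernel ψ χ r.1 r.2 * G r.1 *
      (g r.2.1 * h r.2.2)) ((affineMeasure μ).prod (μ.prod μ)) :=
    ((measurable_waveletKernel hμ hψm hχm).aestronglyMeasurable.mul hG.1.comp_fst).mul
      ((hg.1.comp_fst.mul hh.1.comp_snd).comp_snd)
  have hfac : ∀ q p : K × K, waveletKernel ψ χ q p * G q * (g p.1 * h p.2) =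
      G q * ((g p.1 * conj (daughter χ q.1 q.2 p.1)) * (h p.2 * conj (daughter ψ q.1 q.2 p.2))) := by
    intro q p
    rw [waveletKernel]; ring
  have hint : ∀ {u w : K → ℂ}, MemLp u 2 μ → MemLp w 2 μ → ∀ a b : K, a ≠ 0 →
      Integrable (fun x => w x * conj (daughter u a b x)) μ := fun hu hw a b ha =>
    hw.integrable_mul (memLp_conj (memLp_daughter hu ha b))
  rw [integrable_prod_iff hm]
  refine ⟨?_, ?_⟩
  · filter_upwards [ae_affineMeasure_ne_zero (μ := μ)] with q hq
    simp only [hfac]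
    exact ((hint hχ hg q.1 q.2 hq).mul_prod (hint hψ hh q.1 q.2 hq)).const_mul _
  · set B := ((eLpNorm g 2 μ).toReal * (eLpNorm χ 2 μ).toReal) *
      ((eLpNorm h 2 μ).toReal * (eLpNorm ψ 2 μ).toReal) with hB
    refine (hG.norm.const_mul B).mono' hm.norm.integral_prod_right' ?_
    filter_upwards [ae_affineMeasure_ne_zero (μ := μ)] with q hq
    have hn : ∀ {u w : K → ℂ}, MemLp u 2 μ → MemLp w 2 μ →
        ∫ x, ‖w x * conj (daughter u q.1 q.2 x)‖ ∂μ ≤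
          (eLpNorm w 2 μ).toReal * (eLpNorm u 2 μ).toReal := by
      intro u w hu hw
      have h1 := norm_integral_mul_le (f := fun x => (‖w x‖ : ℂ))
        (g := fun x => (‖daughter u q.1 q.2 x‖ : ℂ)) hw.norm.ofReal
        (memLp_daughter hu hq q.2).norm.ofReal
      have e1 : eLpNorm (fun x => (‖w x‖ : ℂ)) 2 μ = eLpNorm w 2 μ :=
        eLpNorm_congr_norm_ae (ae_of_all _ fun x => by simp)
      have e2 : eLpNorm (fun x => (‖daughter u q.1 q.2 x‖ : ℂ)) 2 μ = eLpNorm u 2 μ := by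
        rw [← eLpNorm_daughter u hq q.2]
        exact eLpNorm_congr_norm_ae (ae_of_all _ fun x => by simp)
      rw [e1, e2] at h1
      refine le_trans (le_of_eq ?_) h1
      have e3 : ∀ x, (‖w x‖ : ℂ) * (‖daughter u q.1 q.2 x‖ : ℂ) =
          ((‖w x * conj (daughter u q.1 q.2 x)‖ : ℝ) : ℂ) := fun x => by simp
      simp_rw [e3]
      rw [integral_complex_ofReal, Complex.norm_real, Real.norm_of_nonneg
        (integral_nonneg fun x => norm_nonneg _)]
    rw [Real.norm_of_nonneg (integral_nonneg fun p => norm_nonneg _)]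
    simp only [hfac, norm_mul]
    rw [integral_const_mul]
    have h2 := integral_prod_mul (μ := μ) (ν := μ) (fun x => ‖g x * conj (daughter χ q.1 q.2 x)‖)
      (fun x => ‖h x * conj (daughter ψ q.1 q.2 x)‖)
    simp only [norm_mul] at h2 hn
    rw [h2, mul_comm]
    refine mul_le_mul_of_nonneg_right (mul_le_mul (hn hχ hg) (hn hψ hh)
      (integral_nonneg fun x => by positivity) (by positivity)) (norm_nonneg _)

theorem waveletForm_eq_integral_of_integrable (hμ : μ {x : K | valuation K x ≤ 1} = 1)
    {ψ χ : K → ℂ}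
    (hψm : Measurable ψ) (hχm : Measurable χ) (hψ : MemLp ψ 2 μ) (hχ : MemLp χ 2 μ)
    {G : K × K → ℂ} (hG : Integrable G (affineMeasure μ)) {h g : K → ℂ} (hh : MemLp h 2 μ)
    (hg : MemLp g 2 μ) :
    Integrable (fun p : K × K => synthesis μ ψ χ G p * (g p.1 * h p.2)) (μ.prod μ) ∧
    waveletForm μ ψ χ G h g = ∫ p, synthesis μ ψ χ G p * (g p.1 * h p.2) ∂(μ.prod μ) := by
  have hi := integrable_waveletKernel_mul hμ hψm hχm hψ hχ hG hh hg
  have e1 : ∀ p : K × K, ∫ q, waveletKernel ψ χ q p * G q * (g p.1 * h p.2) ∂(affineMeasure μ) =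
      synthesis μ ψ χ G p * (g p.1 * h p.2) := fun p => by
    rw [integral_mul_const, synthesis]
  refine ⟨?_, ?_⟩
  · simpa only [e1] using hi.integral_prod_right
  · simp_rw [← e1]
    rw [← integral_integral_swap hi, waveletForm]
    refine integral_congr_ae (ae_of_all _ fun q => ?_)
    have h2 := integral_prod_mul (μ := μ) (ν := μ) (fun x => g x * conj (daughter χ q.1 q.2 x))
      (fun x => h x * conj (daughter ψ q.1 q.2 x))
    simp only [cwt]
    rw [mul_comm (∫ x, h x * conj (daughter ψ q.1 q.2 x) ∂μ), ← h2, ← integral_mul_const]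
    refine integral_congr_ae (ae_of_all _ fun p => ?_)
    simp only [waveletKernel]
    ring

end Kernel

/-! ### Representation of the form by its kernel. -/

section KernelRepresentation

variable {K : Type*} [Field K] [ValuativeRel K] [TopologicalSpace K]
  [IsNonarchimedeanLocalField K] [MeasurableSpace K] [BorelSpace K]
  {μ : Measure K} [μ.IsAddHaarMeasure] {e : AddChar K Circle}

theorem tendsto_zero_of_approx {x : ℕ → ℂ}
    (h : ∀ ε > 0, ∃ y : ℕ → ℂ, Tendsto y atTop (𝓝 0) ∧ ∀ n, ‖x n - y n‖ ≤ ε) :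
    Tendsto x atTop (𝓝 0) := by
  rw [Metric.tendsto_atTop]
  intro ε hε
  obtain ⟨y, hy, hxy⟩ := h (ε / 2) (half_pos hε)
  obtain ⟨N, hN⟩ := (Metric.tendsto_atTop.1 hy) (ε / 2) (half_pos hε)
  refine ⟨N, fun n hn => ?_⟩
  have h1 := hN n hn
  rw [dist_zero_right] at h1 ⊢
  have h2 := norm_add_le (x n - y n) (y n)
  rw [sub_add_cancel] at h2
  linarith [hxy n]

/-- The data of a pair of wavelets for which the kernel calculus below works. -/
structure IsWaveletPair (μ : Measure K) (ψ χ : K → ℂ) (k : ℝ≥0) : Prop where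
  measurable_left : Measurable ψ
  measurable_right : Measurable χ
  memLp_left : MemLp ψ 2 μ
  memLp_right : MemLp χ 2 μ
  lintegral_cwt : ∀ h : K → ℂ, MemLp h 2 μ →
    ∫⁻ q, ‖cwt μ ψ h q.1 q.2‖ₑ ^ 2 ∂(affineMeasure μ) = (k : ℝ≥0∞) * ∫⁻ x, ‖h x‖ₑ ^ 2 ∂μ
  kernel : ∫⁻ q, ‖waveletKernel ψ χ q (1, 0)‖ₑ ^ 2 ∂(affineMeasure μ) ≠ ∞

namespace IsWaveletPair

variable {ψ χ : K → ℂ} {k : ℝ≥0}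

theorem memLp_cwt (hμ : μ {x : K | valuation K x ≤ 1} = 1) (P : IsWaveletPair μ ψ χ k)
    {h : K → ℂ} (hh : MemLp h 2 μ) :
    MemLp (fun q : K × K => cwt μ ψ h q.1 q.2) 2 (affineMeasure μ) := by
  refine memLp_two_of_lintegral_ne_top
    (measurable_cwt hμ P.measurable_left hh.1).aestronglyMeasurable ?_
  rw [P.lintegral_cwt h hh]
  exact ENNReal.mul_ne_top ENNReal.coe_ne_top (lintegral_enorm_sq_ne_top hh)

theorem eLpNorm_cwt (P : IsWaveletPair μ ψ χ k) {h : K → ℂ} (hh : MemLp h 2 μ) :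
    (eLpNorm (fun q : K × K => cwt μ ψ h q.1 q.2) 2 (affineMeasure μ)).toReal =
      √k * (eLpNorm h 2 μ).toReal := by
  have h1 := P.lintegral_cwt h hh
  rw [← eLpNorm_two_sq, ← eLpNorm_two_sq] at h1
  have h2 := congrArg ENNReal.toReal h1
  rw [ENNReal.toReal_mul, ENNReal.toReal_pow, ENNReal.toReal_pow, ENNReal.coe_toReal] at h2
  rw [← sq_eq_sq₀ ENNReal.toReal_nonneg (by positivity), h2, mul_pow, Real.sq_sqrt k.coe_nonneg]

theorem memLp_mul (hμ : μ {x : K | valuation K x ≤ 1} = 1) (P : IsWaveletPair μ ψ χ k)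
    {h g : K → ℂ} (hh : MemLp h 2 μ) (hg : MemLp g 2 μ) :
    MemLp (fun q : K × K => cwt μ ψ h q.1 q.2 * cwt μ χ g q.1 q.2) 2 (affineMeasure μ) :=
  (memLp_cwt_mul_cwt hμ P.measurable_right P.memLp_right hg (P.memLp_cwt hμ hh)).1

theorem norm_waveletForm_le (hμ : μ {x : K | valuation K x ≤ 1} = 1) (P : IsWaveletPair μ ψ χ k)
    {h g : K → ℂ} (hh : MemLp h 2 μ) (hg : MemLp g 2 μ) {H : K × K → ℂ}
    (hH : MemLp H 2 (affineMeasure μ)) :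
    ‖waveletForm μ ψ χ H h g‖ ≤ (eLpNorm χ 2 μ).toReal * √k * (eLpNorm h 2 μ).toReal *
      (eLpNorm g 2 μ).toReal * (eLpNorm H 2 (affineMeasure μ)).toReal := by
  obtain ⟨h1, h2⟩ := memLp_cwt_mul_cwt hμ P.measurable_right P.memLp_right hg (P.memLp_cwt hμ hh)
  refine (norm_integral_mul_le h1 hH).trans ?_
  refine mul_le_mul_of_nonneg_right ?_ ENNReal.toReal_nonneg
  have h3 := ENNReal.toReal_mono (ENNReal.mul_ne_top (ENNReal.mul_ne_top hg.2.ne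
    P.memLp_right.2.ne) (P.memLp_cwt hμ hh).2.ne) h2
  rw [ENNReal.toReal_mul, ENNReal.toReal_mul, P.eLpNorm_cwt hh] at h3
  refine h3.trans (le_of_eq ?_)
  ring

theorem waveletForm_sub (hμ : μ {x : K | valuation K x ≤ 1} = 1) (P : IsWaveletPair μ ψ χ k)
    {h g : K → ℂ} (hh : MemLp h 2 μ) (hg : MemLp g 2 μ) {H G : K × K → ℂ}
    (hH : MemLp H 2 (affineMeasure μ)) (hG : MemLp G 2 (affineMeasure μ)) :
    waveletForm μ ψ χ (H - G) h g = waveletForm μ ψ χ H h g - waveletForm μ ψ χ G h g := by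
  have h1 := P.memLp_mul hμ hh hg
  have i1 : Integrable (fun q : K × K => cwt μ ψ h q.1 q.2 * cwt μ χ g q.1 q.2 * H q)
    (affineMeasure μ) := h1.integrable_mul hH
  have i2 : Integrable (fun q : K × K => cwt μ ψ h q.1 q.2 * cwt μ χ g q.1 q.2 * G q)
    (affineMeasure μ) := h1.integrable_mul hG
  rw [waveletForm, waveletForm, waveletForm, ← integral_sub i1 i2]
  simp only [Pi.sub_apply, mul_sub]

theorem memLp_waveletKernel (hμ : μ {x : K | valuation K x ≤ 1} = 1) (P : IsWaveletPair μ ψ χ k)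
    {p : K × K} (hp : p.1 ≠ p.2) :
    MemLp (fun q => waveletKernel ψ χ q p) 2 (affineMeasure μ) := by
  refine memLp_two_of_lintegral_ne_top ((measurable_waveletKernel hμ P.measurable_left
    P.measurable_right).comp (measurable_id.prodMk measurable_const)).aestronglyMeasurable ?_
  have h1 := lintegral_enorm_waveletKernel_sq hμ P.measurable_left P.measurable_right hp
  refine ne_of_eq_of_ne h1 ?_
  exact ENNReal.mul_ne_top (ENNReal.pow_ne_top (ENNReal.inv_ne_top.2
    (eAbs_ne_zero (sub_ne_zero.2 hp)))) P.kernel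

/-- Cauchy–Schwarz with the homogeneity of the kernel; `C` is the kernel's norm at `(1, 0)`. The
factor `|y - z|⁻¹` is not locally integrable, so this bound alone does not allow a passage to the
limit under the integral. -/
theorem exists_norm_synthesis_sub_le (hμ : μ {x : K | valuation K x ≤ 1} = 1)
    (P : IsWaveletPair μ ψ χ k) : ∃ C : ℝ, 0 ≤ C ∧ ∀ H G : K × K → ℂ,
      MemLp H 2 (affineMeasure μ) → MemLp G 2 (affineMeasure μ) → ∀ p : K × K, p.1 ≠ p.2 →
      ‖synthesis μ ψ χ H p - synthesis μ ψ χ G p‖ ≤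
        (absVal (p.1 - p.2))⁻¹ * C * (eLpNorm (H - G) 2 (affineMeasure μ)).toReal := by
  refine ⟨√(∫⁻ q, ‖waveletKernel ψ χ q (1, 0)‖ₑ ^ 2 ∂(affineMeasure μ)).toReal,
    Real.sqrt_nonneg _, fun H G hH hG p hp => ?_⟩
  have hk := P.memLp_waveletKernel hμ hp
  have i1 : Integrable (fun q => waveletKernel ψ χ q p * H q) (affineMeasure μ) :=
    hk.integrable_mul hH
  have i2 : Integrable (fun q => waveletKernel ψ χ q p * G q) (affineMeasure μ) :=
    hk.integrable_mul hG
  have h1 : synthesis μ ψ χ H p - synthesis μ ψ χ G p =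
      ∫ q, waveletKernel ψ χ q p * (H - G) q ∂(affineMeasure μ) := by
    rw [synthesis, synthesis, ← integral_sub i1 i2]
    simp only [Pi.sub_apply, mul_sub]
  rw [h1]
  refine (norm_integral_mul_le hk (hH.sub hG)).trans (le_of_eq ?_)
  congr 1
  have h2 := lintegral_enorm_waveletKernel_sq hμ P.measurable_left P.measurable_right hp
  rw [← eLpNorm_two_sq] at h2
  have h3 := congrArg ENNReal.toReal h2
  have hpos := absVal_pos (sub_ne_zero.2 hp)
  rw [ENNReal.toReal_mul, ENNReal.toReal_pow, ENNReal.toReal_pow, ENNReal.toReal_inv, eAbs,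
    ENNReal.toReal_ofReal hpos.le] at h3
  rw [← sq_eq_sq₀ ENNReal.toReal_nonneg (by positivity), mul_pow,
    Real.sq_sqrt ENNReal.toReal_nonneg]
  exact h3

end IsWaveletPair

/-- The left side vanishes when `ξ t ∈ 𝔇`; otherwise `|t|⁻¹ ≤ |ξ|`. This cancels the diagonal
singularity of the synthesis bound. -/
theorem norm_character_sub_one_mul_le (hμ : μ {x : K | valuation K x ≤ 1} = 1)
    (he : IsFixedCharacter e) (ξ t : K) :
    ‖(e (ξ * t) : ℂ) - 1‖ * (absVal t)⁻¹ ≤ 2 * absVal ξ := by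
  by_cases h : valuation K (ξ * t) ≤ 1
  · rw [he.trivial_on_integers _ h, Circle.coe_one, sub_self, norm_zero, zero_mul]
    exact mul_nonneg zero_le_two (absVal_nonneg ξ)
  · have ht : t ≠ 0 := by rintro rfl; simp at h
    have h1 : 1 ≤ absVal ξ * absVal t := by
      rw [← absVal_mul, ← absVal_one (K := K)]
      exact absVal_le_absVal hμ one_ne_zero (by rw [map_one]; exact (not_le.1 h).le)
    have h2 : ‖(e (ξ * t) : ℂ) - 1‖ ≤ 2 := by
      refine (norm_sub_le _ _).trans ?_
      rw [Circle.norm_coe, norm_one]; norm_num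
    have h3 := absVal_pos ht
    rw [← div_eq_mul_inv, div_le_iff₀ h3]
    linarith

/-- Multiplication by the character `x ↦ e (ξ x)`. -/
noncomputable def modulate (e : AddChar K Circle) (ξ : K) (h : K → ℂ) (x : K) : ℂ :=
  (e (ξ * x) : ℂ) * h x

theorem memLp_modulate (he : IsFixedCharacter e) (ξ : K) {h : K → ℂ} {p : ℝ≥0∞}
    (hh : MemLp h p μ) : MemLp (modulate e ξ h) p μ := by
  refine (memLp_congr_norm ?_ hh.1 (ae_of_all _ fun x => ?_)).2 hh
  · exact (measurable_character he (by fun_prop)).aestronglyMeasurable.mul hh.1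
  · rw [modulate, norm_mul, Circle.norm_coe, one_mul]

theorem eLpNorm_modulate (ξ : K) (h : K → ℂ) (p : ℝ≥0∞) :
    eLpNorm (modulate e ξ h) p μ = eLpNorm h p μ :=
  eLpNorm_congr_norm_ae (ae_of_all _ fun x => by
    rw [modulate, norm_mul, Circle.norm_coe, one_mul])

theorem modulate_mul_modulate (ξ : K) (h g : K → ℂ) (p : K × K) :
    modulate e (-ξ) g p.1 * modulate e ξ h p.2 =
      (e (ξ * (p.2 - p.1)) : ℂ) * (g p.1 * h p.2) := by
  have : (e (ξ * (p.2 - p.1)) : ℂ) = (e (-ξ * p.1) : ℂ) * (e (ξ * p.2) : ℂ) := by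
    rw [← Circle.coe_mul, ← e.map_add_eq_mul]
    congr 2; ring
  rw [modulate, modulate, this]
  ring

theorem tendsto_integral_mul_character (he : IsFixedCharacter e) {ϖ : K} (h0 : ϖ ≠ 0)
    (h1 : valuation K ϖ < 1) {W : K × K → ℂ} (hW : Integrable W (μ.prod μ)) :
    Tendsto (fun n : ℕ => ∫ p, W p * (e ((ϖ ^ n)⁻¹ * (p.2 - p.1)) : ℂ) ∂(μ.prod μ)) atTop
      (𝓝 0) := by
  obtain ⟨s, -, hs⟩ := he.nontrivial
  -- Shifting the second coordinate by `s ϖ ^ n` multiplies the character by `e s ≠ 1`, and the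
  -- shift tends to `0`.
  refine tendsto_integral_mul_of_quasiperiodic hW (c := (e s : ℂ))
    (E := fun n p => (e ((ϖ ^ n)⁻¹ * (p.2 - p.1)) : ℂ)) (v := fun n => (0, s * ϖ ^ n))
    (fun n => measurable_character he (by fun_prop)) (fun n p => Circle.norm_coe _) ?_
    (fun h => hs (Circle.coe_eq_one.1 h)) (fun n p => ?_)
  · have := (tendsto_pow_zero h1).const_mul s
    rw [mul_zero] at this
    exact tendsto_const_nhds.prodMk_nhds this
  · rw [← Circle.coe_mul, ← e.map_add_eq_mul]
    congr 2
    have hp := pow_ne_zero n h0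
    simp only [Prod.snd_add, Prod.fst_add, add_zero]
    field_simp
    ring

namespace IsWaveletPair

variable {ψ χ : K → ℂ} {k : ℝ≥0}

/-- Modulating the arguments of the form multiplies its kernel by a character; the two changes
agree because the character is trivial near the diagonal. -/
theorem waveletForm_modulate_sub (hμ : μ {x : K | valuation K x ≤ 1} = 1)
    (he : IsFixedCharacter e) (P : IsWaveletPair μ ψ χ k) {H : K × K → ℂ}
    (hH : MemLp H 2 (affineMeasure μ)) {h g : K → ℂ} (hh : MemLp h 2 μ) (hg : MemLp g 2 μ)
    (hh1 : Integrable h μ) (hg1 : Integrable g μ)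
    (hS : Integrable (fun p : K × K => synthesis μ ψ χ H p * (g p.1 * h p.2)) (μ.prod μ)) (ξ : K) :
    waveletForm μ ψ χ H (modulate e ξ h) (modulate e (-ξ) g) - waveletForm μ ψ χ H h g =
      ∫ p : K × K, synthesis μ ψ χ H p * (g p.1 * h p.2) *
        ((e (ξ * (p.2 - p.1)) : ℂ) - 1) ∂(μ.prod μ) := by
  obtain ⟨C, hC, hCb⟩ := P.exists_norm_synthesis_sub_le hμ
  obtain ⟨G, hG, hGlim⟩ := exists_integrable_approx hH
  have hEm : Measurable fun p : K × K => (e (ξ * (p.2 - p.1)) : ℂ) - 1 :=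
    (measurable_character he (by fun_prop)).sub_const 1
  have hE2 : ∀ p : K × K, ‖(e (ξ * (p.2 - p.1)) : ℂ) - 1‖ ≤ 2 := fun p => by
    refine (norm_sub_le _ _).trans ?_
    rw [Circle.norm_coe, norm_one]; norm_num
  have hh' := memLp_modulate he ξ hh
  have hg' := memLp_modulate he (-ξ) hg
  set A := (eLpNorm χ 2 μ).toReal * √k * (eLpNorm h 2 μ).toReal * (eLpNorm g 2 μ).toReal with hA
  set B := 2 * absVal ξ * C * ∫ p : K × K, ‖g p.1 * h p.2‖ ∂(μ.prod μ) with hB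
  have hgh : Integrable (fun p : K × K => g p.1 * h p.2) (μ.prod μ) := hg1.mul_prod hh1
  set L := waveletForm μ ψ χ H (modulate e ξ h) (modulate e (-ξ) g) - waveletForm μ ψ χ H h g
    with hL
  set R := ∫ p : K × K, synthesis μ ψ χ H p * (g p.1 * h p.2) *
    ((e (ξ * (p.2 - p.1)) : ℂ) - 1) ∂(μ.prod μ) with hR
  -- The identity holds exactly for the integrable `G n`. Replacing `G n` by `H` costs at most `A`
  -- times the distance in each of the two forms and `B` times the distance in the integral.
  have key : ∀ n, ‖L - R‖ ≤ (A + A + B) * (eLpNorm (G n - H) 2 (affineMeasure μ)).toReal := by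
    intro n
    have hGi := memLp_one_iff_integrable.1 (hG n).1
    have hG2 := (hG n).2
    set d := (eLpNorm (G n - H) 2 (affineMeasure μ)).toReal with hd
    obtain ⟨i1, e1⟩ := waveletForm_eq_integral_of_integrable hμ P.measurable_left
      P.measurable_right P.memLp_left P.memLp_right hGi hh hg
    obtain ⟨i2, e2⟩ := waveletForm_eq_integral_of_integrable hμ P.measurable_left
      P.measurable_right P.memLp_left P.memLp_right hGi hh' hg'
    have iG : Integrable (fun p : K × K => synthesis μ ψ χ (G n) p * (g p.1 * h p.2) *
        ((e (ξ * (p.2 - p.1)) : ℂ) - 1)) (μ.prod μ) :=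
      i1.mul_bdd (c := 2) hEm.aestronglyMeasurable (ae_of_all _ hE2)
    have iH : Integrable (fun p : K × K => synthesis μ ψ χ H p * (g p.1 * h p.2) *
        ((e (ξ * (p.2 - p.1)) : ℂ) - 1)) (μ.prod μ) :=
      hS.mul_bdd (c := 2) hEm.aestronglyMeasurable (ae_of_all _ hE2)
    have b1 := P.norm_waveletForm_le hμ hh' hg' (hG2.sub hH)
    have b2 := P.norm_waveletForm_le hμ hh hg (hG2.sub hH)
    rw [P.waveletForm_sub hμ hh' hg' hG2 hH, eLpNorm_modulate, eLpNorm_modulate, ← hA, ← hd] at b1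
    rw [P.waveletForm_sub hμ hh hg hG2 hH, ← hA, ← hd] at b2
    have e3 : waveletForm μ ψ χ (G n) (modulate e ξ h) (modulate e (-ξ) g) -
        waveletForm μ ψ χ (G n) h g = ∫ p : K × K, synthesis μ ψ χ (G n) p * (g p.1 * h p.2) *
        ((e (ξ * (p.2 - p.1)) : ℂ) - 1) ∂(μ.prod μ) := by
      rw [e1, e2, ← integral_sub i2 i1]
      refine integral_congr_ae (ae_of_all _ fun p => ?_)
      simp only [modulate_mul_modulate]
      ring
    have b3 : ‖(∫ p : K × K, synthesis μ ψ χ (G n) p * (g p.1 * h p.2) *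
        ((e (ξ * (p.2 - p.1)) : ℂ) - 1) ∂(μ.prod μ)) - R‖ ≤ B * d := by
      rw [hR, ← integral_sub iG iH]
      have hbd : ∀ p : K × K, ‖synthesis μ ψ χ (G n) p * (g p.1 * h p.2) *
          ((e (ξ * (p.2 - p.1)) : ℂ) - 1) - synthesis μ ψ χ H p * (g p.1 * h p.2) *
          ((e (ξ * (p.2 - p.1)) : ℂ) - 1)‖ ≤ 2 * absVal ξ * C * d * ‖g p.1 * h p.2‖ := by
        intro p
        have f1 : synthesis μ ψ χ (G n) p * (g p.1 * h p.2) * ((e (ξ * (p.2 - p.1)) : ℂ) - 1) -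
            synthesis μ ψ χ H p * (g p.1 * h p.2) * ((e (ξ * (p.2 - p.1)) : ℂ) - 1) =
            ((synthesis μ ψ χ (G n) p - synthesis μ ψ χ H p) *
              ((e (ξ * (p.2 - p.1)) : ℂ) - 1)) * (g p.1 * h p.2) := by ring
        rw [f1, norm_mul]
        refine mul_le_mul_of_nonneg_right ?_ (norm_nonneg _)
        -- On the diagonal the synthesis bound is unavailable, but the character factor is zero.
        by_cases hp : p.1 = p.2
        · rw [hp, sub_self, mul_zero, AddChar.map_zero_eq_one, Circle.coe_one, sub_self, mul_zero,
            norm_zero]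
          have := absVal_nonneg ξ
          positivity
        · have f2 := hCb (G n) H hG2 hH p hp
          have f3 := norm_character_sub_one_mul_le hμ he ξ (p.2 - p.1)
          rw [← absVal_neg (p.2 - p.1), neg_sub] at f3
          rw [norm_mul]
          calc _ ≤ ((absVal (p.1 - p.2))⁻¹ * C * d) * ‖(e (ξ * (p.2 - p.1)) : ℂ) - 1‖ :=
                mul_le_mul_of_nonneg_right f2 (norm_nonneg _)
            _ = (‖(e (ξ * (p.2 - p.1)) : ℂ) - 1‖ * (absVal (p.1 - p.2))⁻¹) * (C * d) := by ring
            _ ≤ (2 * absVal ξ) * (C * d) :=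
                mul_le_mul_of_nonneg_right f3 (mul_nonneg hC ENNReal.toReal_nonneg)
            _ = _ := by ring
      refine (norm_integral_le_of_norm_le (hgh.norm.const_mul _) (ae_of_all _ hbd)).trans
        (le_of_eq ?_)
      rw [integral_const_mul, hB]
      ring
    rw [← e3] at b3
    have e4 : L - R = ((waveletForm μ ψ χ (G n) (modulate e ξ h) (modulate e (-ξ) g) -
        waveletForm μ ψ χ (G n) h g) - R) -
        (waveletForm μ ψ χ (G n) (modulate e ξ h) (modulate e (-ξ) g) -
          waveletForm μ ψ χ H (modulate e ξ h) (modulate e (-ξ) g)) +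
        (waveletForm μ ψ χ (G n) h g - waveletForm μ ψ χ H h g) := by
      rw [hL]; ring
    rw [e4]
    refine (norm_add_le _ _).trans ?_
    refine (add_le_add (norm_sub_le _ _) le_rfl).trans ?_
    linarith
  have hz : Tendsto (fun n => (A + A + B) * (eLpNorm (G n - H) 2 (affineMeasure μ)).toReal) atTop
      (𝓝 0) := by
    simpa using ((ENNReal.tendsto_toReal ENNReal.zero_ne_top).comp hGlim).const_mul (A + A + B)
  have := ge_of_tendsto' hz key
  exact sub_eq_zero.1 (norm_le_zero_iff.1 this)

/-- The discrepancy between form and integral is unchanged by modulation, and under modulation by `ξ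
= (ϖ ^ n)⁻¹` both terms tend to `0`. Hence it is `0`. -/
theorem waveletForm_eq_integral_of_integrable (hμ : μ {x : K | valuation K x ≤ 1} = 1)
    (he : IsFixedCharacter e) (P : IsWaveletPair μ ψ χ k) {H : K × K → ℂ}
    (hH : MemLp H 2 (affineMeasure μ)) {h g : K → ℂ} (hh : MemLp h 2 μ) (hg : MemLp g 2 μ)
    (hh1 : Integrable h μ) (hg1 : Integrable g μ)
    (hS : Integrable (fun p : K × K => synthesis μ ψ χ H p * (g p.1 * h p.2)) (μ.prod μ)) :
    waveletForm μ ψ χ H h g =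
      ∫ p : K × K, synthesis μ ψ χ H p * (g p.1 * h p.2) ∂(μ.prod μ) := by
  obtain ⟨ϖ, h0, h1⟩ := exists_valuation_lt_one K
  obtain ⟨G, hG, hGlim⟩ := exists_integrable_approx hH
  set A := (eLpNorm χ 2 μ).toReal * √k * (eLpNorm h 2 μ).toReal * (eLpNorm g 2 μ).toReal with hA
  let T : ℕ → ℂ := fun n =>
    waveletForm μ ψ χ H (modulate e (ϖ ^ n)⁻¹ h) (modulate e (-(ϖ ^ n)⁻¹) g)
  let U : ℕ → ℂ := fun n => ∫ p : K × K, synthesis μ ψ χ H p * (g p.1 * h p.2) *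
    (e ((ϖ ^ n)⁻¹ * (p.2 - p.1)) : ℂ) ∂(μ.prod μ)
  have hU : Tendsto U atTop (𝓝 0) := tendsto_integral_mul_character he h0 h1 hS
  -- For an integrable `G m` in place of `H` this is Riemann–Lebesgue. The replacement error is
  -- uniform in `n` because modulation preserves `L²` norms.
  have hT : Tendsto T atTop (𝓝 0) := by
    refine tendsto_zero_of_approx fun ε hε => ?_
    have hz : Tendsto (fun n => A * (eLpNorm (G n - H) 2 (affineMeasure μ)).toReal) atTop
        (𝓝 0) := by
      simpa using ((ENNReal.tendsto_toReal ENNReal.zero_ne_top).comp hGlim).const_mul A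
    obtain ⟨m, hm⟩ := (hz.eventually (gt_mem_nhds hε)).exists
    have hGi := memLp_one_iff_integrable.1 (hG m).1
    have hG2 := (hG m).2
    refine ⟨fun n => waveletForm μ ψ χ (G m) (modulate e (ϖ ^ n)⁻¹ h) (modulate e (-(ϖ ^ n)⁻¹) g),
      ?_, fun n => ?_⟩
    · obtain ⟨i1, -⟩ := LocalFieldWavelet.waveletForm_eq_integral_of_integrable hμ
        P.measurable_left P.measurable_right P.memLp_left P.memLp_right hGi hh hg
      refine (tendsto_integral_mul_character he h0 h1 i1).congr fun n => ?_
      obtain ⟨-, e2⟩ := LocalFieldWavelet.waveletForm_eq_integral_of_integrable hμ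
        P.measurable_left P.measurable_right P.memLp_left P.memLp_right hGi
        (memLp_modulate he (ϖ ^ n)⁻¹ hh) (memLp_modulate he (-(ϖ ^ n)⁻¹) hg)
      rw [e2]
      refine integral_congr_ae (ae_of_all _ fun p => ?_)
      simp only [modulate_mul_modulate]
      ring
    · have hh' := memLp_modulate he (ϖ ^ n)⁻¹ hh
      have hg' := memLp_modulate he (-(ϖ ^ n)⁻¹) hg
      have b1 := P.norm_waveletForm_le hμ hh' hg' (hG2.sub hH)
      rw [P.waveletForm_sub hμ hh' hg' hG2 hH, eLpNorm_modulate, eLpNorm_modulate, ← hA,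
        norm_sub_rev] at b1
      exact b1.trans hm.le
  have hconst : ∀ n, T n - U n = waveletForm μ ψ χ H h g -
      ∫ p : K × K, synthesis μ ψ χ H p * (g p.1 * h p.2) ∂(μ.prod μ) := by
    intro n
    have e1 := P.waveletForm_modulate_sub hμ he hH hh hg hh1 hg1 hS (ϖ ^ n)⁻¹
    have i1 : Integrable (fun p : K × K => synthesis μ ψ χ H p * (g p.1 * h p.2) *
        (e ((ϖ ^ n)⁻¹ * (p.2 - p.1)) : ℂ)) (μ.prod μ) :=
      hS.mul_bdd (c := 1) (measurable_character he (by fun_prop)).aestronglyMeasurable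
        (ae_of_all _ fun p => (Circle.norm_coe _).le)
    simp only [mul_sub, mul_one] at e1 i1
    rw [integral_sub i1 hS] at e1
    simp only [T, U, mul_sub]
    linear_combination e1
  have hlim := hT.sub hU
  simp only [hconst, sub_zero] at hlim
  exact sub_eq_zero.1 (tendsto_nhds_unique tendsto_const_nhds hlim)

theorem waveletForm_sub_left (hμ : μ {x : K | valuation K x ≤ 1} = 1) (P : IsWaveletPair μ ψ χ k)
    {h h' g : K → ℂ} (hh : MemLp h 2 μ) (hh' : MemLp h' 2 μ) (hg : MemLp g 2 μ) {H : K × K → ℂ}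
    (hH : MemLp H 2 (affineMeasure μ)) :
    waveletForm μ ψ χ H (fun x => h x - h' x) g =
      waveletForm μ ψ χ H h g - waveletForm μ ψ χ H h' g := by
  have i1 : Integrable (fun q : K × K => cwt μ ψ h q.1 q.2 * cwt μ χ g q.1 q.2 * H q)
    (affineMeasure μ) := (P.memLp_mul hμ hh hg).integrable_mul hH
  have i2 : Integrable (fun q : K × K => cwt μ ψ h' q.1 q.2 * cwt μ χ g q.1 q.2 * H q)
    (affineMeasure μ) := (P.memLp_mul hμ hh' hg).integrable_mul hH
  rw [waveletForm, waveletForm, waveletForm, ← integral_sub i1 i2]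
  refine integral_congr_ae ?_
  filter_upwards [ae_affineMeasure_ne_zero (μ := μ)] with q hq
  have := cwt_add_const_mul P.memLp_left hh hh' (-1) hq q.2
  simp only [neg_one_mul, ← sub_eq_add_neg] at this
  rw [this]
  ring

theorem waveletForm_sub_right (hμ : μ {x : K | valuation K x ≤ 1} = 1) (P : IsWaveletPair μ ψ χ k)
    {h g g' : K → ℂ} (hh : MemLp h 2 μ) (hg : MemLp g 2 μ) (hg' : MemLp g' 2 μ) {H : K × K → ℂ}
    (hH : MemLp H 2 (affineMeasure μ)) :
    waveletForm μ ψ χ H h (fun x => g x - g' x) =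
      waveletForm μ ψ χ H h g - waveletForm μ ψ χ H h g' := by
  have i1 : Integrable (fun q : K × K => cwt μ ψ h q.1 q.2 * cwt μ χ g q.1 q.2 * H q)
    (affineMeasure μ) := (P.memLp_mul hμ hh hg).integrable_mul hH
  have i2 : Integrable (fun q : K × K => cwt μ ψ h q.1 q.2 * cwt μ χ g' q.1 q.2 * H q)
    (affineMeasure μ) := (P.memLp_mul hμ hh hg').integrable_mul hH
  rw [waveletForm, waveletForm, waveletForm, ← integral_sub i1 i2]
  refine integral_congr_ae ?_
  filter_upwards [ae_affineMeasure_ne_zero (μ := μ)] with q hq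
  have := cwt_add_const_mul P.memLp_right hg hg' (-1) hq q.2
  simp only [neg_one_mul, ← sub_eq_add_neg] at this
  rw [this]
  ring

end IsWaveletPair

theorem tendsto_eLpNorm_sub_indicator {f : K → ℂ} (hf : MemLp f 2 μ) {V : ℕ → Set K}
    (hV : AECover μ atTop V) :
    Tendsto (fun n => (eLpNorm (fun x => f x - (V n).indicator f x) 2 μ).toReal) atTop (𝓝 0) := by
  have h1 : Tendsto (fun n => ∫⁻ x, ‖f x - (V n).indicator f x‖ₑ ^ 2 ∂μ) atTop
      (𝓝 (∫⁻ _, 0 ∂μ)) := by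
    refine tendsto_lintegral_of_dominated_convergence' (fun x => ‖f x‖ₑ ^ 2) (fun n => ?_)
      (fun n => ae_of_all _ fun x => ?_) (lintegral_enorm_sq_ne_top hf) ?_
    · exact (hf.1.sub (hf.1.indicator (hV.measurableSet n))).enorm.pow_const 2
    · by_cases hx : x ∈ V n <;> simp [hx]
    · filter_upwards [hV.ae_eventually_mem] with x hx
      refine tendsto_const_nhds.congr' ?_
      filter_upwards [hx] with n hn
      simp [hn]
  rw [lintegral_zero] at h1
  have h2 := (ENNReal.tendsto_toReal ENNReal.zero_ne_top).comp h1
  have h3 := (Real.continuous_sqrt.tendsto 0).comp h2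
  rw [Real.sqrt_zero] at h3
  refine h3.congr fun n => ?_
  simp only [Function.comp_apply]
  rw [← eLpNorm_two_sq, ENNReal.toReal_pow, Real.sqrt_sq ENNReal.toReal_nonneg]

theorem exists_aecover_finite (hμ : μ {x : K | valuation K x ≤ 1} = 1) :
    ∃ V : ℕ → Set K, (AECover μ atTop V) ∧ (∀ n, μ (V n) ≠ ∞) ∧ ∀ x, ∀ᶠ n in atTop, x ∈ V n := by
  obtain ⟨ϖ, h0, h1⟩ := exists_valuation_lt_one K
  have hmem : ∀ x : K, ∀ᶠ n : ℕ in atTop, valuation K x ≤ valuation K (ϖ ^ n)⁻¹ := by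
    intro x
    obtain ⟨n, hn⟩ := exists_valuation_le_inv_pow h0 h1 x
    filter_upwards [eventually_ge_atTop n] with m hm
    refine hn.trans ?_
    rw [map_inv₀, map_inv₀]
    exact inv_anti₀ (by simp [zero_lt_iff, h0]) (antitone_valuation_pow h1 hm)
  refine ⟨fun n => {ξ | valuation K ξ ≤ valuation K (ϖ ^ n)⁻¹},
    ⟨ae_of_all _ hmem, fun n => measurableSet_valuation_le _⟩, fun n => ?_, hmem⟩
  rw [measure_valuation_le hμ (inv_ne_zero (pow_ne_zero n h0))]
  exact eAbs_ne_top _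

/-- If the kernel of the form is integrable against `h` and `g`, then it represents the form. -/
theorem IsWaveletPair.waveletForm_eq_integral (hμ : μ {x : K | valuation K x ≤ 1} = 1)
    (he : IsFixedCharacter e) {ψ χ : K → ℂ} {k : ℝ≥0} (P : IsWaveletPair μ ψ χ k) {H : K × K → ℂ}
    (hH : MemLp H 2 (affineMeasure μ)) {h g : K → ℂ} (hh : MemLp h 2 μ) (hg : MemLp g 2 μ)
    (hS : Integrable (fun p : K × K => synthesis μ ψ χ H p * (g p.1 * h p.2)) (μ.prod μ)) :
    waveletForm μ ψ χ H h g =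
      ∫ p : K × K, synthesis μ ψ χ H p * (g p.1 * h p.2) ∂(μ.prod μ) := by
  -- Cutting `h` and `g` off to sets of finite measure makes them integrable. The form converges by
  -- its boundedness, and the integrals over `V n ×ˢ V n` converge because the full integrand is
  -- integrable.
  obtain ⟨V, hV, hVfin, hmem⟩ := exists_aecover_finite (μ := μ) hμ
  have hW : AECover (μ.prod μ) atTop fun n => V n ×ˢ V n :=
    ⟨ae_of_all _ fun p => (hmem p.1).and (hmem p.2), fun n =>
      (hV.measurableSet n).prod (hV.measurableSet n)⟩
  have hlim := hW.integral_tendsto_of_countably_generated hS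
  have hind : ∀ {f : K → ℂ}, MemLp f 2 μ → ∀ n, MemLp ((V n).indicator f) 2 μ := fun hf n =>
    hf.indicator (hV.measurableSet n)
  have hint : ∀ {f : K → ℂ}, MemLp f 2 μ → ∀ n, Integrable ((V n).indicator f) μ := fun hf n => by
    rw [integrable_indicator_iff (hV.measurableSet n)]
    have : IsFiniteMeasure (μ.restrict (V n)) :=
      ⟨by rw [Measure.restrict_apply_univ]; exact (hVfin n).lt_top⟩
    exact (hf.restrict (V n)).integrable one_le_two
  have heq : ∀ n, waveletForm μ ψ χ H ((V n).indicator h) ((V n).indicator g) =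
      ∫ p in V n ×ˢ V n, synthesis μ ψ χ H p * (g p.1 * h p.2) ∂(μ.prod μ) := by
    intro n
    have hprod : ∀ p : K × K, synthesis μ ψ χ H p * ((V n).indicator g p.1 * (V n).indicator h p.2)
        = (V n ×ˢ V n).indicator (fun p => synthesis μ ψ χ H p * (g p.1 * h p.2)) p := by
      intro p
      by_cases h1 : p.1 ∈ V n <;> by_cases h2 : p.2 ∈ V n <;> simp [h1, h2, Set.indicator]
    have hm : MeasurableSet (V n ×ˢ V n) := (hV.measurableSet n).prod (hV.measurableSet n)
    rw [P.waveletForm_eq_integral_of_integrable hμ he hH (hind hh n) (hind hg n) (hint hh n)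
      (hint hg n)]
    · simp_rw [hprod]
      rw [integral_indicator hm]
    · simp_rw [hprod]
      exact hS.indicator hm
  have hform : Tendsto (fun n => waveletForm μ ψ χ H ((V n).indicator h) ((V n).indicator g)) atTop
      (𝓝 (waveletForm μ ψ χ H h g)) := by
    rw [tendsto_iff_norm_sub_tendsto_zero]
    set c := (eLpNorm χ 2 μ).toReal * √k with hc
    set d := (eLpNorm H 2 (affineMeasure μ)).toReal with hd
    have hb : ∀ n, ‖waveletForm μ ψ χ H ((V n).indicator h) ((V n).indicator g) -
        waveletForm μ ψ χ H h g‖ ≤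
        c * (eLpNorm (fun x => h x - (V n).indicator h x) 2 μ).toReal * (eLpNorm g 2 μ).toReal * d +
        c * (eLpNorm h 2 μ).toReal *
          (eLpNorm (fun x => g x - (V n).indicator g x) 2 μ).toReal * d := by
      intro n
      have b1 := P.norm_waveletForm_le hμ (hh.sub (hind hh n)) hg hH
      have b2 := P.norm_waveletForm_le hμ (hind hh n) (hg.sub (hind hg n)) hH
      have b3 : (eLpNorm ((V n).indicator h) 2 μ).toReal ≤ (eLpNorm h 2 μ).toReal :=
        ENNReal.toReal_mono hh.2.ne (eLpNorm_indicator_le h)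
      have e1 := P.waveletForm_sub_left hμ hh (hind hh n) hg hH
      have e2 := P.waveletForm_sub_right hμ (hind hh n) hg (hind hg n) hH
      have e3 : waveletForm μ ψ χ H ((V n).indicator h) ((V n).indicator g) -
          waveletForm μ ψ χ H h g = -(waveletForm μ ψ χ H (fun x => h x - (V n).indicator h x) g +
          waveletForm μ ψ χ H ((V n).indicator h) (fun x => g x - (V n).indicator g x)) := by
        rw [e1, e2]; ring
      rw [e3, norm_neg]
      refine (norm_add_le _ _).trans (add_le_add b1 (b2.trans ?_))
      exact mul_le_mul_of_nonneg_right (mul_le_mul_of_nonneg_right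
        (mul_le_mul_of_nonneg_left b3 (by positivity)) ENNReal.toReal_nonneg) ENNReal.toReal_nonneg
    refine squeeze_zero (fun n => norm_nonneg _) hb ?_
    have t1 := tendsto_eLpNorm_sub_indicator hh hV
    have t2 := tendsto_eLpNorm_sub_indicator hg hV
    have t3 := ((((t1.const_mul c).mul_const (eLpNorm g 2 μ).toReal).mul_const d).add
      ((t2.const_mul (c * (eLpNorm h 2 μ).toReal)).mul_const d))
    simpa using t3
  simp only [heq] at hform
  exact tendsto_nhds_unique hform hlim

end KernelRepresentation

/-! ### The basic function and the pairing with truncated test functions. -/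

section BasicFunction

variable {K : Type*} [Field K] [ValuativeRel K] [TopologicalSpace K]
  [IsNonarchimedeanLocalField K] [MeasurableSpace K] [BorelSpace K]
  {μ : Measure K} [μ.IsAddHaarMeasure] {e : AddChar K Circle} {ψ φ χ : K → ℂ} {D : K → K → K → ℂ}

theorem IsBasicFunction.congr {ψ' φ' χ' : K → ℂ} (hD : IsBasicFunction μ ψ φ χ D)
    (hψ : ψ =ᵐ[μ] ψ') (hφ : φ =ᵐ[μ] φ') (hχ : χ =ᵐ[μ] χ') : IsBasicFunction μ ψ' φ' χ' D := by
  refine ⟨hD.1, hD.2, fun a b ha => ?_⟩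
  filter_upwards [hD.3 a b ha, Measure.quasiMeasurePreserving_fst.ae (daughter_congr hχ ha b),
    Measure.quasiMeasurePreserving_snd.ae (daughter_congr hψ ha b)] with p h1 h2 h3
  rw [← cwt_congr_left hφ ha b, h1, h2, h3]

/-- The exceptional null set in the definition depends on `(a, b)`. Exchanging the two quantifiers
requires a jointly measurable set, hence the measurable representative `D'`. -/
theorem IsBasicFunction.ae_cwt_eq (hμ : μ {x : K | valuation K x ≤ 1} = 1)
    (hψ : Measurable ψ) (hφ : Measurable φ) (hχ : Measurable χ)
    (hD : IsBasicFunction μ ψ φ χ D) :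
    ∀ᵐ p : K × K ∂(μ.prod μ), ∀ᵐ q ∂(affineMeasure μ),
      cwt μ φ (fun x => D x p.1 p.2) q.1 q.2 = waveletKernel ψ χ q p := by
  let D' := hD.1.mk
  have hD'm : Measurable D' := hD.1.stronglyMeasurable_mk.measurable
  have hDD' : ∀ᵐ p : K × K ∂(μ.prod μ), (fun x => D x p.1 p.2) =ᵐ[μ] fun x => D' (x, p) := by
    have h1 := (Measure.measurePreserving_swap (μ := μ.prod μ) (ν := μ)).quasiMeasurePreserving.ae
      hD.1.ae_eq_mk
    exact Measure.ae_ae_of_ae_prod h1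
  have hm1 : Measurable fun r : (K × K) × (K × K) => cwt μ φ (fun x => D' (x, r.2)) r.1.1 r.1.2 := by
    have h1 : Measurable fun s : ((K × K) × (K × K)) × K =>
        D' (s.2, s.1.2) * conj (daughter φ s.1.1.1 s.1.1.2 s.2) := by
      have h2 : Measurable fun s : ((K × K) × (K × K)) × K => (s.1.1, s.2) := by fun_prop
      have h3 : Measurable fun s : ((K × K) × (K × K)) × K => (s.2, s.1.2) := by fun_prop
      exact (hD'm.comp h3).mul
        (Complex.continuous_conj.measurable.comp ((measurable_daughter hμ hφ).comp h2))
    exact (h1.stronglyMeasurable.integral_prod_right' (ν := μ)).measurable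
  have hset := measurableSet_eq_fun hm1 (measurable_waveletKernel hμ hψ hχ)
  have h1 : ∀ᵐ q ∂(affineMeasure μ), ∀ᵐ p : K × K ∂(μ.prod μ),
      cwt μ φ (fun x => D' (x, p)) q.1 q.2 = waveletKernel ψ χ q p := by
    filter_upwards [ae_affineMeasure_ne_zero (μ := μ)] with q hq
    filter_upwards [hD.3 q.1 q.2 hq, hDD'] with p hp1 hp2
    rw [← cwt_congr_right hp2, hp1, waveletKernel]
  have h2 := (Measure.ae_ae_comm hset).1 h1
  filter_upwards [h2, hDD'] with p hp1 hp2
  filter_upwards [hp1] with q hq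
  rw [cwt_congr_right hp2, hq]

/-- The wavelet `φ`, with Fourier transform `Φ`, has the finite nonzero admissibility constant
`c`. -/
structure IsAnalyzing (e : AddChar K Circle) (μ : Measure K) (φ Φ : K → ℂ) (c : ℝ≥0) : Prop where
  measurable : Measurable φ
  measurable_fourier : Measurable Φ
  isL2Fourier : IsL2Fourier e μ φ Φ
  constant : ∫⁻ ξ, ‖Φ ξ‖ₑ ^ 2 / eAbs ξ ∂μ = c

namespace IsAnalyzing

variable {Φ : K → ℂ} {c : ℝ≥0}

theorem constant_ne_top (A : IsAnalyzing e μ φ Φ c) : ∫⁻ ξ, ‖Φ ξ‖ₑ ^ 2 / eAbs ξ ∂μ ≠ ∞ := by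
  rw [A.constant]; exact ENNReal.coe_ne_top

theorem memLp_conj_cwt (hμ : μ {x : K | valuation K x ≤ 1} = 1) (he : IsFixedCharacter e)
    (A : IsAnalyzing e μ φ Φ c) {u : K → ℂ} (hu : MemLp u 2 μ) :
    MemLp (fun q : K × K => conj (cwt μ φ u q.1 q.2)) 2 (affineMeasure μ) :=
  memLp_conj (memLp_cwt hμ he A.measurable A.measurable_fourier A.isL2Fourier A.constant_ne_top hu)

theorem eLpNorm_conj_cwt (hμ : μ {x : K | valuation K x ≤ 1} = 1) (he : IsFixedCharacter e)
    (A : IsAnalyzing e μ φ Φ c) {u : K → ℂ} (hu : MemLp u 2 μ) :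
    (eLpNorm (fun q : K × K => conj (cwt μ φ u q.1 q.2)) 2 (affineMeasure μ)).toReal =
      √c * (eLpNorm u 2 μ).toReal := by
  have h0 : eLpNorm (fun q : K × K => conj (cwt μ φ u q.1 q.2)) 2 (affineMeasure μ) =
      eLpNorm (fun q : K × K => cwt μ φ u q.1 q.2) 2 (affineMeasure μ) :=
    eLpNorm_congr_norm_ae (ae_of_all _ fun q => by simp)
  have h1 := lintegral_enorm_cwt_sq hμ he A.measurable A.measurable_fourier A.isL2Fourier
    A.constant_ne_top hu
  rw [← eLpNorm_two_sq, ← eLpNorm_two_sq, A.constant] at h1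
  have h2 := congrArg ENNReal.toReal h1
  rw [ENNReal.toReal_mul, ENNReal.toReal_pow, ENNReal.toReal_pow, ENNReal.coe_toReal] at h2
  rw [h0, ← sq_eq_sq₀ ENNReal.toReal_nonneg (by positivity), h2, mul_pow,
    Real.sq_sqrt c.coe_nonneg]

/-- For almost every `(y, z)` the kernel is the wavelet transform of `D(·, y, z)`, so this is the
orthogonality relation for `φ`. -/
theorem ae_synthesis_eq (hμ : μ {x : K | valuation K x ≤ 1} = 1) (he : IsFixedCharacter e)
    (A : IsAnalyzing e μ φ Φ c) (hψ : Measurable ψ) (hχ : Measurable χ)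
    (hD : IsBasicFunction μ ψ φ χ D) {u : K → ℂ} (hu : MemLp u 2 μ) :
    ∀ᵐ p : K × K ∂(μ.prod μ),
      synthesis μ ψ χ (fun q => conj (cwt μ φ u q.1 q.2)) p =
        (c : ℂ) * ∫ x, D x p.1 p.2 * conj (u x) ∂μ := by
  filter_upwards [hD.ae_cwt_eq hμ hψ A.measurable hχ, hD.2] with p hp1 hp2
  have h1 := integral_cwt_mul_conj hμ he A.measurable A.measurable_fourier A.isL2Fourier
    A.constant_ne_top hp2 hu
  rw [A.constant, ENNReal.coe_toReal] at h1
  rw [← h1]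
  refine integral_congr_ae ?_
  filter_upwards [hp1] with q hq
  rw [hq]

/-- The existence of `D` forces this: at almost every `(y, z)` the kernel is the transform of an
`L²` function, and homogeneity carries finiteness from one off-diagonal point to `(1, 0)`. -/
theorem kernel_ne_top (hμ : μ {x : K | valuation K x ≤ 1} = 1) (he : IsFixedCharacter e)
    (A : IsAnalyzing e μ φ Φ c) (hψ : Measurable ψ) (hχ : Measurable χ)
    (hD : IsBasicFunction μ ψ φ χ D) :
    ∫⁻ q, ‖waveletKernel ψ χ q (1, 0)‖ₑ ^ 2 ∂(affineMeasure μ) ≠ ∞ := by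
  have h1 : ∀ᵐ p : K × K ∂(μ.prod μ),
      ∫⁻ q, ‖waveletKernel ψ χ q p‖ₑ ^ 2 ∂(affineMeasure μ) ≠ ∞ := by
    filter_upwards [hD.ae_cwt_eq hμ hψ A.measurable hχ, hD.2] with p hp1 hp2
    have h2 := lintegral_enorm_sq_ne_top (memLp_cwt hμ he A.measurable A.measurable_fourier
      A.isL2Fourier A.constant_ne_top hp2)
    refine ne_of_eq_of_ne (lintegral_congr_ae ?_) h2
    filter_upwards [hp1] with q hq
    rw [hq]
  obtain ⟨y, hy⟩ := (Measure.ae_ae_of_ae_prod h1).exists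
  obtain ⟨z, hz, hzy⟩ := (hy.and (Measure.ae_ne μ y)).exists
  intro h3
  rw [lintegral_enorm_waveletKernel_sq hμ hψ hχ hzy.symm, h3, ENNReal.mul_top] at hz
  · exact hz rfl
  · exact pow_ne_zero 2 (ENNReal.inv_ne_zero.2 (eAbs_ne_top _))

end IsAnalyzing

variable {h g : K → ℂ}

theorem assocConv_ae_eq
    (hconv : ∀ᵐ x ∂μ, Integrable (fun p : K × K => D x p.1 p.2 * h p.2 * g p.1) (μ.prod μ)) :
    assocConv μ D h g =ᵐ[μ] fun x => ∫ p : K × K, D x p.1 p.2 * h p.2 * g p.1 ∂(μ.prod μ) := by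
  filter_upwards [hconv] with x hx
  rw [integral_prod _ hx, assocConv]
  simp only [translation, integral_mul_const]

theorem aestronglyMeasurable_triple (hD : IsBasicFunction μ ψ φ χ D) (hh : MemLp h 2 μ)
    (hg : MemLp g 2 μ) :
    AEStronglyMeasurable (fun r : K × K × K => D r.1 r.2.1 r.2.2 * h r.2.2 * g r.2.1)
      (μ.prod (μ.prod μ)) :=
  (hD.1.mul hh.1.comp_snd.comp_snd).mul hg.1.comp_fst.comp_snd

/-- The pairing of the associated convolution with a bounded function supported on a set of finite
measure on which the defining double integral is bounded. -/
theorem integral_assocConv_mul_conj_indicator (hμ : μ {x : K | valuation K x ≤ 1} = 1)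
    (he : IsFixedCharacter e) {Φ : K → ℂ} {c k : ℝ≥0} (A : IsAnalyzing e μ φ Φ c)
    (P : IsWaveletPair μ ψ χ k) (hD : IsBasicFunction μ ψ φ χ D) (hh : MemLp h 2 μ)
    (hg : MemLp g 2 μ)
    (hconv : ∀ᵐ x ∂μ, Integrable (fun p : K × K => D x p.1 p.2 * h p.2 * g p.1) (μ.prod μ))
    {u : K → ℂ} (hu : AEStronglyMeasurable u μ) {E : Set K} (hE : MeasurableSet E) (hEfin : μ E ≠ ∞)
    {N : ℝ} (hN : 0 ≤ N)
    (hbd : ∀ᵐ x ∂μ, x ∈ E → ‖u x‖ ≤ N ∧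
      ∫ p : K × K, ‖D x p.1 p.2 * h p.2 * g p.1‖ ∂(μ.prod μ) ≤ N) :
    MemLp (E.indicator u) 2 μ ∧
    (c : ℂ) * ∫ x, assocConv μ D h g x * conj (E.indicator u x) ∂μ =
      waveletForm μ ψ χ (fun q => conj (cwt μ φ (E.indicator u) q.1 q.2)) h g := by
  have hEf : IsFiniteMeasure (μ.restrict E) :=
    ⟨by rw [Measure.restrict_apply_univ]; exact hEfin.lt_top⟩
  have hw : MemLp (E.indicator u) 2 μ := by
    rw [memLp_indicator_iff_restrict hE]
    refine MemLp.of_bound hu.restrict N ?_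
    rw [ae_restrict_iff' hE]
    filter_upwards [hbd] with x hx hxE using (hx hxE).1
  refine ⟨hw, ?_⟩
  set w := E.indicator u with hwdef
  have hwc := memLp_conj hw
  have hm : AEStronglyMeasurable (fun r : K × K × K => D r.1 r.2.1 r.2.2 * h r.2.2 * g r.2.1 *
      conj (w r.1)) (μ.prod (μ.prod μ)) :=
    (aestronglyMeasurable_triple hD hh hg).mul hwc.1.comp_fst
  -- The truncation supplies the joint integrability that the hypothesis lacks: the inner integral
  -- and the test function are each at most `N` on `E`, which has finite measure.
  have hint : Integrable (fun r : K × K × K => D r.1 r.2.1 r.2.2 * h r.2.2 * g r.2.1 *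
      conj (w r.1)) (μ.prod (μ.prod μ)) := by
    refine (integrable_prod_iff hm).2 ⟨?_, ?_⟩
    · filter_upwards [hconv] with x hx using hx.mul_const _
    · have hind : Integrable (E.indicator fun _ => N * N) μ :=
        (integrable_indicator_iff hE).2 (integrableOn_const hEfin)
      refine hind.mono' hm.norm.integral_prod_right' ?_
      filter_upwards [hbd] with x hx
      rw [Real.norm_of_nonneg (integral_nonneg fun p => norm_nonneg _)]
      simp only [norm_mul, RCLike.norm_conj]
      rw [integral_mul_const]
      by_cases hxE : x ∈ E
      · obtain ⟨h1, h2⟩ := hx hxE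
        simp only [norm_mul] at h2
        rw [hwdef, Set.indicator_of_mem hxE, Set.indicator_of_mem hxE]
        exact mul_le_mul h2 h1 (norm_nonneg _) hN
      · rw [hwdef, Set.indicator_of_notMem hxE, Set.indicator_of_notMem hxE, norm_zero, mul_zero]
  have hsyn := A.ae_synthesis_eq hμ he P.measurable_left P.measurable_right hD hw
  have hH := A.memLp_conj_cwt hμ he hw
  have e1 : ∀ p : K × K, ∫ x, D x p.1 p.2 * h p.2 * g p.1 * conj (w x) ∂μ =
      (∫ x, D x p.1 p.2 * conj (w x) ∂μ) * (g p.1 * h p.2) := by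
    intro p
    rw [← integral_mul_const]
    refine integral_congr_ae (ae_of_all _ fun x => ?_)
    ring
  have hae : (fun p : K × K => synthesis μ ψ χ (fun q => conj (cwt μ φ w q.1 q.2)) p *
      (g p.1 * h p.2)) =ᵐ[μ.prod μ]
      fun p => (c : ℂ) * ∫ x, D x p.1 p.2 * h p.2 * g p.1 * conj (w x) ∂μ := by
    filter_upwards [hsyn] with p hp
    rw [hp, e1, mul_assoc]
  have hS : Integrable (fun p : K × K => synthesis μ ψ χ (fun q => conj (cwt μ φ w q.1 q.2)) p *
      (g p.1 * h p.2)) (μ.prod μ) :=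
    (integrable_congr hae).2 (hint.integral_prod_right.const_mul _)
  rw [P.waveletForm_eq_integral hμ he hH hh hg hS, integral_congr_ae hae, integral_const_mul,
    ← integral_integral_swap hint]
  congr 1
  refine integral_congr_ae ?_
  filter_upwards [assocConv_ae_eq hconv] with x hx
  rw [hx, integral_mul_const]

end BasicFunction

/-! ### Square integrability of the convolution and the product formula. -/

section Convolution

variable {K : Type*} [Field K] [ValuativeRel K] [TopologicalSpace K]
  [IsNonarchimedeanLocalField K] [MeasurableSpace K] [BorelSpace K]
  {μ : Measure K} [μ.IsAddHaarMeasure] {e : AddChar K Circle} {ψ φ χ : K → ℂ} {D : K → K → K → ℂ}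
  {Φ : K → ℂ} {c k : ℝ≥0} {h g : K → ℂ}

theorem exists_aecover_bounded (hμ : μ {x : K | valuation K x ≤ 1} = 1) {u : K → ℂ}
    (hu : AEStronglyMeasurable u μ) {M : K → ℝ} (hM : AEStronglyMeasurable M μ) :
    ∃ E : ℕ → Set K, AECover μ atTop E ∧ (∀ n, μ (E n) ≠ ∞) ∧
      ∀ n : ℕ, ∀ᵐ x ∂μ, x ∈ E n → ‖u x‖ ≤ n ∧ M x ≤ n := by
  obtain ⟨V, hV, hVfin, hmem⟩ := exists_aecover_finite (μ := μ) hμ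
  have hum : Measurable fun x => ‖hu.mk u x‖ := hu.stronglyMeasurable_mk.measurable.norm
  have hMm : Measurable (hM.mk M) := hM.stronglyMeasurable_mk.measurable
  refine ⟨fun n => V n ∩ {x | ‖hu.mk u x‖ ≤ n ∧ hM.mk M x ≤ n}, ⟨ae_of_all _ fun x => ?_,
    fun n => ?_⟩, fun n => ?_, fun n => ?_⟩
  · obtain ⟨n₁, h₁⟩ := exists_nat_ge ‖hu.mk u x‖
    obtain ⟨n₂, h₂⟩ := exists_nat_ge (hM.mk M x)
    filter_upwards [hmem x, eventually_ge_atTop n₁, eventually_ge_atTop n₂] with n hn hn₁ hn₂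
    exact ⟨hn, h₁.trans (by exact_mod_cast hn₁), h₂.trans (by exact_mod_cast hn₂)⟩
  · exact (hV.measurableSet n).inter ((measurableSet_le hum measurable_const).inter
      (measurableSet_le hMm measurable_const))
  · exact measure_ne_top_of_subset Set.inter_subset_left (hVfin n)
  · filter_upwards [hu.ae_eq_mk, hM.ae_eq_mk] with x h1 h2 hx
    rw [h1, h2]
    exact hx.2

theorem aestronglyMeasurable_assocConv (hD : IsBasicFunction μ ψ φ χ D) (hh : MemLp h 2 μ)
    (hg : MemLp g 2 μ)
    (hconv : ∀ᵐ x ∂μ, Integrable (fun p : K × K => D x p.1 p.2 * h p.2 * g p.1) (μ.prod μ)) :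
    AEStronglyMeasurable (assocConv μ D h g) μ :=
  (aestronglyMeasurable_triple hD hh hg).integral_prod_right'.congr (assocConv_ae_eq hconv).symm

/-- Duality: testing `f = h # g` against its own truncation of norm `t` gives `c t² ≤ B c t`, hence
`t ≤ B` uniformly along the exhausting sets. Here `c ≠ 0` is used. -/
theorem memLp_assocConv (hμ : μ {x : K | valuation K x ≤ 1} = 1)
    (he : IsFixedCharacter e) (A : IsAnalyzing e μ φ Φ c) (hc : c ≠ 0)
    (P : IsWaveletPair μ ψ χ k) (hD : IsBasicFunction μ ψ φ χ D) (hh : MemLp h 2 μ)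
    (hg : MemLp g 2 μ)
    (hconv : ∀ᵐ x ∂μ, Integrable (fun p : K × K => D x p.1 p.2 * h p.2 * g p.1) (μ.prod μ)) :
    MemLp (assocConv μ D h g) 2 μ := by
  set f := assocConv μ D h g with hf
  have hfm : AEStronglyMeasurable f μ := aestronglyMeasurable_assocConv hD hh hg hconv
  obtain ⟨E, hE, hEfin, hEb⟩ := exists_aecover_bounded hμ hfm
    (aestronglyMeasurable_triple hD hh hg).norm.integral_prod_right'
  set B := (eLpNorm χ 2 μ).toReal * √k * (eLpNorm h 2 μ).toReal * (eLpNorm g 2 μ).toReal * √c / c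
    with hB
  have hcpos : (0 : ℝ) < c := by exact_mod_cast pos_iff_ne_zero.2 hc
  have hbound : ∀ n, ∫⁻ x in E n, ‖f x‖ₑ ^ 2 ∂μ ≤ ENNReal.ofReal B ^ 2 := by
    intro n
    obtain ⟨hw, heq⟩ := integral_assocConv_mul_conj_indicator hμ he A P hD hh hg hconv hfm
      (hE.measurableSet n) (hEfin n) n.cast_nonneg (hEb n)
    have b1 := P.norm_waveletForm_le hμ hh hg (A.memLp_conj_cwt hμ he hw)
    rw [A.eLpNorm_conj_cwt hμ he hw, ← heq, norm_mul] at b1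
    have e1 : ∫ x, assocConv μ D h g x * conj ((E n).indicator f x) ∂μ =
        (((eLpNorm ((E n).indicator f) 2 μ).toReal ^ 2 : ℝ) : ℂ) := by
      rw [← ENNReal.toReal_pow, eLpNorm_two_sq, ← autocorrelation_zero hw, autocorrelation]
      refine integral_congr_ae (ae_of_all _ fun x => ?_)
      simp only [add_zero]
      by_cases hx : x ∈ E n
      · rw [Set.indicator_of_mem hx, ← hf, mul_comm]
      · rw [Set.indicator_of_notMem hx, map_zero, mul_zero, mul_zero]
    rw [e1, Complex.norm_real, Complex.norm_real, Real.norm_of_nonneg (sq_nonneg _),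
      Real.norm_of_nonneg NNReal.zero_le_coe] at b1
    set t := (eLpNorm ((E n).indicator f) 2 μ).toReal with ht
    have ht0 : 0 ≤ t := ENNReal.toReal_nonneg
    have hB0 : 0 ≤ B := by positivity
    have hBc : B * c = (eLpNorm χ 2 μ).toReal * √k * (eLpNorm h 2 μ).toReal *
      (eLpNorm g 2 μ).toReal * √c := div_mul_cancel₀ _ hcpos.ne'
    have b2 : t ≤ B := by
      by_contra hcon
      have hcon := not_le.1 hcon
      have : (c : ℝ) * t ^ 2 ≤ (B * c) * t := by rw [hBc]; linarith
      have h3 : 0 < t := hB0.trans_lt hcon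
      nlinarith [mul_pos hcpos h3]
    have e3 : ∫⁻ x in E n, ‖f x‖ₑ ^ 2 ∂μ = eLpNorm ((E n).indicator f) 2 μ ^ 2 := by
      rw [eLpNorm_indicator_eq_eLpNorm_restrict (hE.measurableSet n), eLpNorm_two_sq]
    rw [e3]
    refine pow_le_pow_left' ?_ 2
    rw [← ENNReal.ofReal_toReal hw.2.ne]
    exact ENNReal.ofReal_le_ofReal b2
  have hlim := hE.lintegral_tendsto_of_nat (f := fun x => ‖f x‖ₑ ^ 2) (hfm.enorm.pow_const 2)
  refine memLp_two_of_lintegral_ne_top hfm (ne_top_of_le_ne_top ?_ (le_of_tendsto' hlim hbound))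
  exact ENNReal.pow_ne_top ENNReal.ofReal_ne_top

theorem waveletForm_conj_cwt_sub (hμ : μ {x : K | valuation K x ≤ 1} = 1)
    (he : IsFixedCharacter e) (A : IsAnalyzing e μ φ Φ c) (P : IsWaveletPair μ ψ χ k)
    (hh : MemLp h 2 μ) (hg : MemLp g 2 μ) {u w : K → ℂ} (hu : MemLp u 2 μ) (hw : MemLp w 2 μ) :
    waveletForm μ ψ χ (fun q => conj (cwt μ φ (fun x => u x - w x) q.1 q.2)) h g =
      waveletForm μ ψ χ (fun q => conj (cwt μ φ u q.1 q.2)) h g -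
        waveletForm μ ψ χ (fun q => conj (cwt μ φ w q.1 q.2)) h g := by
  rw [← P.waveletForm_sub hμ hh hg (A.memLp_conj_cwt hμ he hu) (A.memLp_conj_cwt hμ he hw)]
  refine integral_congr_ae ?_
  filter_upwards [ae_affineMeasure_ne_zero (μ := μ)] with q hq
  have := cwt_add_const_mul A.isL2Fourier.1 hu hw (-1) hq q.2
  simp only [neg_one_mul, ← sub_eq_add_neg] at this
  rw [this, Pi.sub_apply, map_sub]

/-- Now that the convolution is known to be in `L²`, both sides are continuous in `u`, so the
identity for truncations extends to all of `L²`. -/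
theorem integral_assocConv_mul_conj (hμ : μ {x : K | valuation K x ≤ 1} = 1)
    (he : IsFixedCharacter e) (A : IsAnalyzing e μ φ Φ c) (hc : c ≠ 0)
    (P : IsWaveletPair μ ψ χ k) (hD : IsBasicFunction μ ψ φ χ D) (hh : MemLp h 2 μ)
    (hg : MemLp g 2 μ)
    (hconv : ∀ᵐ x ∂μ, Integrable (fun p : K × K => D x p.1 p.2 * h p.2 * g p.1) (μ.prod μ))
    {u : K → ℂ} (hu : MemLp u 2 μ) :
    (c : ℂ) * ∫ x, assocConv μ D h g x * conj (u x) ∂μ =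
      waveletForm μ ψ χ (fun q => conj (cwt μ φ u q.1 q.2)) h g := by
  have hf := memLp_assocConv hμ he A hc P hD hh hg hconv
  set f := assocConv μ D h g
  obtain ⟨E, hE, hEfin, hEb⟩ := exists_aecover_bounded hμ hu.1
    (aestronglyMeasurable_triple hD hh hg).norm.integral_prod_right'
  have hall := fun n => integral_assocConv_mul_conj_indicator hμ he A P hD hh hg hconv hu.1
      (hE.measurableSet n) (hEfin n) n.cast_nonneg (hEb n)
  have ht := tendsto_eLpNorm_sub_indicator hu hE
  have hl1 : Tendsto (fun n => ∫ x, f x * conj ((E n).indicator u x) ∂μ) atTop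
      (𝓝 (∫ x, f x * conj (u x) ∂μ)) := by
    rw [tendsto_iff_norm_sub_tendsto_zero]
    have ht' := ht.const_mul (eLpNorm f 2 μ).toReal
    rw [mul_zero] at ht'
    refine squeeze_zero (fun n => norm_nonneg _) (fun n => ?_) ht'
    have hw := (hall n).1
    have i1 : Integrable (fun x => f x * conj (u x)) μ := hf.integrable_mul (memLp_conj hu)
    have i2 : Integrable (fun x => f x * conj ((E n).indicator u x)) μ :=
      hf.integrable_mul (memLp_conj hw)
    rw [norm_sub_rev, ← integral_sub i1 i2]
    simp only [← mul_sub, ← map_sub]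
    refine (norm_integral_mul_le hf (memLp_conj (hu.sub hw))).trans (le_of_eq ?_)
    congr 2
    exact eLpNorm_congr_norm_ae (ae_of_all _ fun x => by
      simp only [Pi.sub_apply, RCLike.norm_conj])
  have hl2 : Tendsto (fun n => waveletForm μ ψ χ
      (fun q => conj (cwt μ φ ((E n).indicator u) q.1 q.2)) h g) atTop
      (𝓝 (waveletForm μ ψ χ (fun q => conj (cwt μ φ u q.1 q.2)) h g)) := by
    rw [tendsto_iff_norm_sub_tendsto_zero]
    have ht' := (ht.const_mul √c).const_mul ((eLpNorm χ 2 μ).toReal * √k *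
      (eLpNorm h 2 μ).toReal * (eLpNorm g 2 μ).toReal)
    rw [mul_zero, mul_zero] at ht'
    refine squeeze_zero (fun n => norm_nonneg _) (fun n => ?_) ht'
    have hw := (hall n).1
    have hsub : MemLp (fun x => u x - (E n).indicator u x) 2 μ := hu.sub hw
    rw [norm_sub_rev, ← waveletForm_conj_cwt_sub hμ he A P hh hg hu hw]
    refine (P.norm_waveletForm_le hμ hh hg (A.memLp_conj_cwt hμ he hsub)).trans (le_of_eq ?_)
    rw [A.eLpNorm_conj_cwt hμ he hsub]
  have hl3 := hl1.const_mul (c : ℂ)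
  rw [tendsto_congr fun n => (hall n).2] at hl3
  exact tendsto_nhds_unique hl3 hl2

/-- Take `u = φ_{a,b}`. The defining property of `D` makes the synthesised kernel `c conj χ_{a,b}(y)
conj ψ_{a,b}(z)`, integrable against `g ⊗ h` as a product of integrable functions, so the form is
represented and the integral factors. Each `(a, b)` is treated on its own, so no exceptional set
remains. -/
theorem cwt_assocConv (hμ : μ {x : K | valuation K x ≤ 1} = 1)
    (he : IsFixedCharacter e) (A : IsAnalyzing e μ φ Φ c) (hc : c ≠ 0)
    (P : IsWaveletPair μ ψ χ k) (hD : IsBasicFunction μ ψ φ χ D) (hh : MemLp h 2 μ)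
    (hg : MemLp g 2 μ)
    (hconv : ∀ᵐ x ∂μ, Integrable (fun p : K × K => D x p.1 p.2 * h p.2 * g p.1) (μ.prod μ))
    {a : K} (ha : a ≠ 0) (b : K) :
    cwt μ φ (assocConv μ D h g) a b = cwt μ ψ h a b * cwt μ χ g a b := by
  have hu : MemLp (daughter φ a b) 2 μ := memLp_daughter A.isL2Fourier.1 ha b
  have hcC : (c : ℂ) ≠ 0 := by exact_mod_cast hc
  have hsyn : ∀ᵐ p : K × K ∂(μ.prod μ),
      synthesis μ ψ χ (fun q => conj (cwt μ φ (daughter φ a b) q.1 q.2)) p * (g p.1 * h p.2) =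
        (c : ℂ) * ((g p.1 * conj (daughter χ a b p.1)) * (h p.2 * conj (daughter ψ a b p.2))) := by
    filter_upwards [A.ae_synthesis_eq hμ he P.measurable_left P.measurable_right hD hu,
      hD.3 a b ha] with p h1 h2
    rw [cwt] at h2
    rw [h1, h2]
    ring
  have i1 : Integrable (fun y => g y * conj (daughter χ a b y)) μ :=
    hg.integrable_mul (memLp_conj (memLp_daughter P.memLp_right ha b))
  have i2 : Integrable (fun z => h z * conj (daughter ψ a b z)) μ :=
    hh.integrable_mul (memLp_conj (memLp_daughter P.memLp_left ha b))
  have hS := (integrable_congr hsyn).2 ((i1.mul_prod i2).const_mul _)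
  have h1 := integral_assocConv_mul_conj hμ he A hc P hD hh hg hconv hu
  rw [P.waveletForm_eq_integral hμ he (A.memLp_conj_cwt hμ he hu) hh hg hS,
    integral_congr_ae hsyn, integral_const_mul] at h1
  have h2 := mul_left_cancel₀ hcC h1
  rw [integral_prod_mul (fun y => g y * conj (daughter χ a b y))
    (fun z => h z * conj (daughter ψ a b z)), mul_comm] at h2
  exact h2

end Convolution

end LocalFieldWavelet

/-! ### The theorem, by passage to measurable representatives of the wavelets. -/

theorem mainTheorem4 {K : Type*} [Field K] [ValuativeRel K] [TopologicalSpace K]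
    [IsNonarchimedeanLocalField K] [MeasurableSpace K] [BorelSpace K]
    (μ : Measure K) [μ.IsAddHaarMeasure] (hμ : μ {x : K | valuation K x ≤ 1} = 1)
    (e : AddChar K Circle) (he : LocalFieldWavelet.IsFixedCharacter e)
    (ψ φ χ : K → ℂ)
    (hψ : LocalFieldWavelet.IsAdmissibleWavelet e μ ψ)
    (hφ : LocalFieldWavelet.IsAdmissibleWavelet e μ φ)
    (hχ : LocalFieldWavelet.IsAdmissibleWavelet e μ χ)
    (hcφ : LocalFieldWavelet.admissibilityConstant e μ φ ≠ 0)
    (D : K → K → K → ℂ) (hD : LocalFieldWavelet.IsBasicFunction μ ψ φ χ D)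
    (h g : K → ℂ) (hh : MemLp h 2 μ) (hg : MemLp g 2 μ)
    (hconv : ∀ᵐ x ∂μ, Integrable (fun p : K × K => D x p.1 p.2 * h p.2 * g p.1) (μ.prod μ)) :
    MemLp (LocalFieldWavelet.assocConv μ D h g) 2 μ ∧
      ∀ a b : K, a ≠ 0 →
        LocalFieldWavelet.cwt μ φ (LocalFieldWavelet.assocConv μ D h g) a b =
          LocalFieldWavelet.cwt μ ψ h a b * LocalFieldWavelet.cwt μ χ g a b := by
  open LocalFieldWavelet in
  obtain ⟨ψ', Ψ, hψm, hΨm, hψe, hψF, hψc⟩ := hψ.exists_measurable hμ he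
  obtain ⟨φ', Φ, hφm, hΦm, hφe, hφF, hφc⟩ := hφ.exists_measurable hμ he
  obtain ⟨χ', X, hχm, -, hχe, hχF, -⟩ := hχ.exists_measurable hμ he
  have hD' := hD.congr hψe hφe hχe
  have hA : IsAnalyzing e μ φ' Φ (admissibilityConstant e μ φ).toNNReal :=
    ⟨hφm, hΦm, hφF, by rw [hφc, ENNReal.coe_toNNReal hφ.2.ne]⟩
  have hP : IsWaveletPair μ ψ' χ' (admissibilityConstant e μ ψ).toNNReal := by
    refine ⟨hψm, hχm, hψF.1, hχF.1, fun f hf => ?_, hA.kernel_ne_top hμ he hψm hχm hD'⟩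
    rw [lintegral_enorm_cwt_sq hμ he hψm hΨm hψF (hψc.trans_ne hψ.2.ne) hf, hψc,
      ENNReal.coe_toNNReal hψ.2.ne]
  have hc : (admissibilityConstant e μ φ).toNNReal ≠ 0 :=
    (ENNReal.toNNReal_pos hcφ hφ.2.ne).ne'
  refine ⟨memLp_assocConv hμ he hA hc hP hD' hh hg hconv, fun a b ha => ?_⟩
  rw [cwt_congr_left hφe ha, cwt_congr_left hψe ha, cwt_congr_left hχe ha]
  exact cwt_assocConv hμ he hA hc hP hD' hh hg hconv ha b
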